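/- Write $\Omega=\{0,1,2\}^{\mathbb N}$, let $\sigma$ be the shift on $\Omega$, let $[\omega_1\dots\omega_n]\subset\Omega$ be the set of the sequences beginning with $\omega_1,\dots,\omega_n$, and let $\|v\|=\sum_i|v_i|$ for $v\in\mathbb R^7$. For $e\in\{0,1\}$ let $$M_0=\begin{pmatrix}1&0&0&0&0&0&0\\0&0&1&0&0&0&0\\0&0&0&1&1&0&0\\0&0&0&0&0&0&0\\1&0&0&0&0&0&1\\0&0&0&0&1&0&0\\0&1&0&0&0&0&0\end{pmatrix},\quad M_1=\begin{pmatrix}0&0&1&1&0&0&0\\0&0&0&0&0&1&0\\0&0&0&1&1&0&0\\1&0&0&0&0&0&0\\0&0&1&0&0&0&0\\0&0&0&0&0&0&0\\0&0&0&0&0&0&0\end{pmatrix},\quad M_2=\begin{pmatrix}1&0&0&0&1&0&1\\0&0&0&0&0&0&0\\1&0&0&0&0&0&1\\0&0&0&1&1&0&0\\0&0&0&0&1&0&0\\0&0&0&0&e&0&0\\0&0&0&0&0&0&0\end{pmatrix}.$$ (i) For both values of $e$ and for every column-vector $c\in\mathbb R^7$ with positive entries, all the vectors $M_{\omega_1}\cdots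 M_{\omega_n}c$ are non-zero and the sequence $n\mapsto\dfrac{M_{\omega_1}\cdots M_{\omega_n}c}{\|M_{\omega_1}\cdots M_{\omega_n}c\|}$ converges uniformly in $\omega\in\Omega$. (ii) Let $\beta\approx1.755$ be the real solution of $\beta^3=2\beta^2-\beta+1$, and let $\nu_{\beta,2}$ be the distribution of $\sum_{n\ge1}\xi_n\beta^{-n}$, where the $\xi_n$ are independent and take each of the values $0,1$ with probability $\tfrac12$. Let $\mu$ be the probability measure $A\mapsto\nu_{\beta,2}\big(\tfrac{1}{\beta-1}A\big)$ on $[0,1]$. Then $\mu$ has the weak-Gibbs property with respect to the numeration in base $\beta$, in the following sense. Put $w_0=0$, $w_1=10$, $w_2=1100$, and for $i_1,\dots,i_n\in\{0,1,2\}$ let $$I_{i_1\dots i_n}=\Big[\sum_{j=1}^m\varepsilon_j\beta^{-j},\ \beta^{-m}+\sum_{j=1}^m\varepsilon_j\beta^{-j}\Big),$$ where $\varepsilon_1\dots\varepsilon_m$ is the concatenation of $w_{i_1},\dots,w_{i_n}$; equivalently $I_{i_1\dots i_n}=S_{i_1}\circ\dots\circ S_{i_n}([0,1))$, where $S_0(x)=\frac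 x\beta$, $S_1(x)=\frac1\beta+\frac x{\beta^2}$, $S_2(x)=\frac1\beta+\frac1{\beta^2}+\frac x{\beta^4}$ are affine contractions for which $S_0([0,1))$, $S_1([0,1))$, $S_2([0,1))$ form a partition of $[0,1)$. There is a Borel probability measure $\nu$ on $\Omega$ with $\nu([\omega_1\dots\omega_n])=\mu(I_{\omega_1\dots\omega_n})$ for all $n\ge 0$ and $\omega\in\Omega$, and there is a continuous $\Phi:\Omega\to\mathbb R$ such that $$\lim_{n\to\infty}\left(\frac{\nu([\omega_1\dots\omega_n])}{\exp\big(\sum_{k=0}^{n-1}\Phi(\sigma^k\omega)\big)}\right)^{1/n}=1\quad\text{uniformly in }\omega\in\Omega.$$ -/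

import Mathlib

open MeasureTheory Filter Topology Set

noncomputable section

namespace WeakGibbs

/-! ### Products of matrices -/

/-- The product `M_{ω_0} M_{ω_1} ⋯ M_{ω_{n-1}}` (the identity for `n = 0`). -/
def prefixProd {b d : ℕ} (M : Fin b → Matrix (Fin d) (Fin d) ℝ) (ω : ℕ → Fin b) :
    ℕ → Matrix (Fin d) (Fin d) ℝ
  | 0 => 1
  | n + 1 => prefixProd M ω n * M (ω n)

/-- The norm of a vector: the sum of the absolute values of its entries. -/
def l1norm {d : ℕ} (v : Fin d → ℝ) : ℝ := ∑ i, |v i|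

/-- The normalized vector `v / ‖v‖`. -/
def normalized {d : ℕ} (v : Fin d → ℝ) : Fin d → ℝ := (l1norm v)⁻¹ • v

def M₀ : Matrix (Fin 7) (Fin 7) ℝ :=
  !![1, 0, 0, 0, 0, 0, 0;
     0, 0, 1, 0, 0, 0, 0;
     0, 0, 0, 1, 1, 0, 0;
     0, 0, 0, 0, 0, 0, 0;
     1, 0, 0, 0, 0, 0, 1;
     0, 0, 0, 0, 1, 0, 0;
     0, 1, 0, 0, 0, 0, 0]

def M₁ : Matrix (Fin 7) (Fin 7) ℝ :=
  !![0, 0, 1, 1, 0, 0, 0;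
     0, 0, 0, 0, 0, 1, 0;
     0, 0, 0, 1, 1, 0, 0;
     1, 0, 0, 0, 0, 0, 0;
     0, 0, 1, 0, 0, 0, 0;
     0, 0, 0, 0, 0, 0, 0;
     0, 0, 0, 0, 0, 0, 0]

/-- The third matrix, with its entry in row 6, column 5 left as a parameter `e`. It is used for
`e = 1` and for `e = 0`. -/
def M₂ (e : ℝ) : Matrix (Fin 7) (Fin 7) ℝ :=
  !![1, 0, 0, 0, 1, 0, 1;
     0, 0, 0, 0, 0, 0, 0;
     1, 0, 0, 0, 0, 0, 1;
     0, 0, 0, 1, 1, 0, 0;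
     0, 0, 0, 0, 1, 0, 0;
     0, 0, 0, 0, e, 0, 0;
     0, 0, 0, 0, 0, 0, 0]

/-- The family `M₀, M₁, M₂`. -/
def matrices (e : ℝ) : Fin 3 → Matrix (Fin 7) (Fin 7) ℝ := ![M₀, M₁, M₂ e]

/-! ### Bernoulli convolutions -/

/-- The Bernoulli convolution associated to `β > 1` and to a probability vector
`p = (p_0, …, p_N)`: the distribution of `∑_{n ≥ 1} ω_n / β ^ n`, where the digits
`ω_n ∈ {0, …, N}` are independent and each of them has distribution `p`. -/
def bernoulliConvolution (β : ℝ) {N : ℕ} (p : PMF (Fin (N + 1))) : Measure ℝ :=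
  (Measure.infinitePi fun _ : ℕ => p.toMeasure).map
    fun ω : ℕ → Fin (N + 1) => ∑' n : ℕ, ((ω n : ℕ) : ℝ) / β ^ (n + 1)

/-- The Bernoulli convolution with the two digits `0, 1` and `p_0 = p_1 = 1/2`. -/
def fairBernoulliConvolution (β : ℝ) : Measure ℝ :=
  bernoulliConvolution β (PMF.uniformOfFintype (Fin (1 + 1)))

/-- The measure `A ↦ ν (A / (β - 1))`, where `ν` is `fairBernoulliConvolution β`: the image of `ν`
under `x ↦ (β - 1) x`. It is carried by `[0, 1]`. -/
def rescaledBernoulliConvolution (β : ℝ) : Measure ℝ :=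
  (fairBernoulliConvolution β).map fun x => (β - 1) * x

/-! ### The weak Gibbs property -/

/-- The one-sided shift, iterated `k` times. -/
def shift {b : ℕ} (k : ℕ) (ω : ℕ → Fin b) : ℕ → Fin b := fun n => ω (n + k)

/-- A measure `ν` on `{0, …, b - 1}^ℕ` has the weak Gibbs property if there is a continuous
potential `Φ` such that `(ν [ω_0 … ω_{n-1}] / exp (∑_{k < n} Φ (σ^k ω))) ^ (1 / n)` tends to `1`,
uniformly in `ω`. Here `PiNat.cylinder ω n` is the set of the sequences that coincide with `ω` on
the first `n` symbols. -/
def IsWeakGibbs {b : ℕ} (ν : Measure (ℕ → Fin b)) : Prop :=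
  ∃ Φ : (ℕ → Fin b) → ℝ, Continuous Φ ∧
    TendstoUniformly
      (fun (n : ℕ) (ω : ℕ → Fin b) =>
        (ν.real (PiNat.cylinder ω n) /
          Real.exp (∑ k ∈ Finset.range n, Φ (shift k ω))) ^ (1 / (n : ℝ)))
      (fun _ => 1) atTop

/-- `S_{ω_0} ∘ ⋯ ∘ S_{ω_{n-1}}` (the identity for `n = 0`). -/
def iterComp {b : ℕ} (S : Fin b → ℝ → ℝ) (ω : ℕ → Fin b) : ℕ → ℝ → ℝ
  | 0 => id
  | n + 1 => iterComp S ω n ∘ S (ω n)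

/-- The basic interval `S_{ω_0} ∘ ⋯ ∘ S_{ω_{n-1}} ([0, 1))`. -/
def basicInterval {b : ℕ} (S : Fin b → ℝ → ℝ) (ω : ℕ → Fin b) (n : ℕ) : Set ℝ :=
  iterComp S ω n '' Ico 0 1

/-- The maps `S_0, …, S_{b-1}` are affine contractions and the images of `[0, 1)` under them form
a partition of `[0, 1)`. -/
structure IsAffineSystem {b : ℕ} (S : Fin b → ℝ → ℝ) : Prop where
  affine : ∀ k, ∃ r a : ℝ, |r| < 1 ∧ ∀ x, S k x = r * x + a
  cover : ⋃ k, S k '' Ico (0 : ℝ) 1 = Ico 0 1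
  disjoint : Pairwise fun k l => Disjoint (S k '' Ico (0 : ℝ) 1) (S l '' Ico (0 : ℝ) 1)

/-- A probability measure `μ` on `[0, 1]` has the weak Gibbs property with respect to a system `S`
of affine contractions if the probability measure `ν` on `{0, …, b - 1}^ℕ` that gives to each
cylinder the `μ`-mass of the corresponding basic interval exists and has the weak Gibbs
property. -/
structure IsWeakGibbsFor {b : ℕ} (S : Fin b → ℝ → ℝ) (μ : Measure ℝ) : Prop where
  isProbabilityMeasure : IsProbabilityMeasure μ
  ae_mem : ∀ᵐ x ∂μ, x ∈ Icc (0 : ℝ) 1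
  isAffineSystem : IsAffineSystem S
  exists_coding : ∃ ν : Measure (ℕ → Fin b), IsProbabilityMeasure ν ∧
    (∀ ω n, ν (PiNat.cylinder ω n) = μ (basicInterval S ω n)) ∧ IsWeakGibbs ν

/-! ### Numeration in base `β` -/

/-- For a word `w = ε_1 … ε_m`, the map `x ↦ ε_1 / β + ⋯ + ε_m / β ^ m + x / β ^ m`. -/
def wordMap (β : ℝ) (w : List ℕ) (x : ℝ) : ℝ := w.foldr (fun ε y => ((ε : ℝ) + y) / β) x

/-- The numeration in base `β`, for the real root `β` of `β ^ 3 = 2 * β ^ 2 - β + 1`: the expansion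
of `1` in base `β` is `1101`, so the expansions of the points of `[0, 1)` are the concatenations of
the words `0`, `10`, `1100`. The basic interval of `i_1 … i_n` is
`[∑ ε_i / β ^ i, 1 / β ^ m + ∑ ε_i / β ^ i)`, where `ε_1 … ε_m` is the concatenation of the words
with numbers `i_1, …, i_n`. -/
def betaSystem (β : ℝ) : Fin 3 → ℝ → ℝ :=
  ![wordMap β [0], wordMap β [1, 0], wordMap β [1, 1, 0, 0]]

end WeakGibbs

end

namespace WeakGibbs

/-! ### The norm and the normalization -/

section Norm

variable {d : ℕ}

/-! Part (i). Every positive `c` lies in a cone `polyCone (coneForms t)` once `t` is large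
(`exists_mem_cone`), and all three matrices preserve the nonzero vectors of that cone
(`matrices_mulVec_mem_cone'`). Hence no product annihilates `c`. A cone-preserving block `Q` is
contracting when the images of the cone lie, up to bounded factors, along one vector `u`. A fixed
proportion of every normalized image can then be split off as the same vector, so appending `Q` on
the right of a product shrinks the oscillation by a factor `1 - θ` that does not depend on the
product (`IsContracting.exists_oscLE`). The words 20, 21, 111, 101, 0001, 1001 are contracting, and
each sequence contains infinitely many of them unless it ends with 000… or 222…
(`exists_contractingBlock`). Powers of `M₀` and `M₂` are not contracting: they fix a vector `u` of
the cone on which the coordinate `k = 0`, respectively `k = 4`, vanishes. But `M_a ^ N y` is `N κ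
y_k u` up to a bounded error, and a vector `y` produced by another letter, or equal to `c`, has
`y_k` comparable with its norm. So the direction still tends to that of `u`
(`local_cauchy_of_eventually_eq`). Both cases give a Cauchy estimate on a cylinder around each
sequence, and compactness of the sequence space makes the convergence uniform.

Part (ii). Let `l` be the limit in (i). Since the first matrix acts last, the increment of log-norm
caused by the first letter is close to `log ‖M_{ω 0} l(σω)‖`, which is continuous; the log-norm is
therefore a Birkhoff sum up to `o(n)` (`exists_birkhoff_approx`). The coordinates 0, 2, 4 are
smaller than the norm by at most a factor of order `n + 1`, which disappears in the `n`-th root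
(`isWeakGibbs_of_matrices`). It remains to write the masses of basic intervals as such products. The
measure is self-similar under `x ↦ x / β` and `x ↦ (x + β - 1) / β`. Expanding an interval along the
letters of a word produces translates by elements `a + bβ + cβ²`; those outside `[0, 1)` have mass
zero, and seven combinations of the surviving ones are transformed by `M₀`, `M₁`, `M₂ 0`, with
weight 1/2 per letter (`massVec_betaWord`). The measure on sequences is the image of `μ` under the
coding of points by their expansions (`betaCode`). -/

lemma l1norm_nonneg (v : Fin d → ℝ) : 0 ≤ l1norm v :=
  Finset.sum_nonneg fun _ _ => abs_nonneg _

lemma abs_le_l1norm (v : Fin d → ℝ) (i : Fin d) : |v i| ≤ l1norm v :=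
  Finset.single_le_sum (f := fun i => |v i|) (fun _ _ => abs_nonneg _) (Finset.mem_univ i)

lemma l1norm_pos {v : Fin d → ℝ} (hv : v ≠ 0) : 0 < l1norm v := by
  obtain ⟨i, hi⟩ := Function.ne_iff.1 hv
  exact (abs_pos.2 hi).trans_le (abs_le_l1norm v i)

@[simp] lemma l1norm_zero : l1norm (0 : Fin d → ℝ) = 0 := by simp [l1norm]

lemma l1norm_smul (a : ℝ) (v : Fin d → ℝ) : l1norm (a • v) = |a| * l1norm v := by
  simp [l1norm, abs_mul, Finset.mul_sum]

lemma l1norm_of_nonneg {v : Fin d → ℝ} (hv : 0 ≤ v) : l1norm v = ∑ i, v i :=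
  Finset.sum_congr rfl fun i _ => abs_of_nonneg (hv i)

lemma l1norm_add_of_nonneg {v w : Fin d → ℝ} (hv : 0 ≤ v) (hw : 0 ≤ w) :
    l1norm (v + w) = l1norm v + l1norm w := by
  rw [l1norm_of_nonneg hv, l1norm_of_nonneg hw, l1norm_of_nonneg (add_nonneg hv hw),
    ← Finset.sum_add_distrib]
  rfl

lemma continuous_l1norm : Continuous (l1norm : (Fin d → ℝ) → ℝ) := by
  unfold l1norm; fun_prop

lemma normalized_smul {a : ℝ} (ha : 0 < a) (v : Fin d → ℝ) :
    normalized (a • v) = normalized v := by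
  rw [normalized, normalized, l1norm_smul, abs_of_pos ha, smul_smul, mul_inv]
  congr 1
  field_simp

lemma continuousAt_normalized {v : Fin d → ℝ} (hv : v ≠ 0) :
    ContinuousAt (normalized : (Fin d → ℝ) → (Fin d → ℝ)) v :=
  (continuous_l1norm.continuousAt.inv₀ (l1norm_pos hv).ne').smul continuousAt_id

lemma l1norm_normalized {v : Fin d → ℝ} (hv : v ≠ 0) : l1norm (normalized v) = 1 := by
  have := l1norm_pos hv
  rw [normalized, l1norm_smul, abs_of_pos (inv_pos.2 this), inv_mul_cancel₀ this.ne']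

lemma l1norm_smul_normalized (v : Fin d → ℝ) : l1norm v • normalized v = v := by
  rcases eq_or_ne v 0 with rfl | hv
  · simp
  · rw [normalized, smul_smul, mul_inv_cancel₀ (l1norm_pos hv).ne', one_smul]

lemma normalized_le_one (v : Fin d → ℝ) (i : Fin d) : |normalized v i| ≤ 1 := by
  rcases eq_or_ne v 0 with rfl | hv
  · simp [normalized]
  · exact (abs_le_l1norm _ i).trans_eq (l1norm_normalized hv)

end Norm

/-! ### Products of matrices along a sequence -/

section Prod

variable {b d : ℕ} (M : Fin b → Matrix (Fin d) (Fin d) ℝ)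

lemma shift_shift (m n : ℕ) (ω : ℕ → Fin b) : shift m (shift n ω) = shift (n + m) ω := by
  funext k; simp only [shift]; congr 1; ring

lemma prefixProd_add (ω : ℕ → Fin b) (n m : ℕ) :
    prefixProd M ω (n + m) = prefixProd M ω n * prefixProd M (shift n ω) m := by
  induction m with
  | zero => simp [prefixProd]
  | succ m ih =>
    rw [← add_assoc, prefixProd, prefixProd, ih, Matrix.mul_assoc]
    simp [shift, add_comm]

lemma prefixProd_one (ω : ℕ → Fin b) : prefixProd M ω 1 = M (ω 0) := by
  simp [prefixProd]

lemma prefixProd_succ' (ω : ℕ → Fin b) (n : ℕ) :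
    prefixProd M ω (n + 1) = M (ω 0) * prefixProd M (shift 1 ω) n := by
  rw [add_comm, prefixProd_add, prefixProd_one]

lemma prefixProd_congr {ω η : ℕ → Fin b} {n : ℕ} (h : ∀ i < n, ω i = η i) :
    prefixProd M ω n = prefixProd M η n := by
  induction n with
  | zero => rfl
  | succ n ih =>
    rw [prefixProd, prefixProd, ih fun i hi => h i (hi.trans n.lt_succ_self), h n n.lt_succ_self]

lemma prefixProd_const {ω : ℕ → Fin b} {a : Fin b} {n : ℕ} (h : ∀ i < n, ω i = a) :
    prefixProd M ω n = M a ^ n := by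
  induction n with
  | zero => rfl
  | succ n ih =>
    rw [prefixProd, ih fun i hi => h i (hi.trans n.lt_succ_self), h n n.lt_succ_self, pow_succ]

lemma prefixProd_invariant {K : Set (Fin d → ℝ)} (hK : ∀ a, ∀ x ∈ K, (M a).mulVec x ∈ K)
    (ω : ℕ → Fin b) (n : ℕ) : ∀ x ∈ K, (prefixProd M ω n).mulVec x ∈ K := by
  induction n with
  | zero => intro x hx; simpa [prefixProd] using hx
  | succ n ih =>
    intro x hx
    rw [prefixProd, ← Matrix.mulVec_mulVec]
    exact ih _ (hK _ _ hx)

lemma prefixProd_nonneg (hM : ∀ a i j, 0 ≤ M a i j) (ω : ℕ → Fin b) (n : ℕ) :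
    ∀ i j, 0 ≤ prefixProd M ω n i j := by
  induction n with
  | zero => intro i j; simp only [prefixProd, Matrix.one_apply]; split_ifs <;> norm_num
  | succ n ih =>
    intro i j
    rw [prefixProd, Matrix.mul_apply]
    exact Finset.sum_nonneg fun k _ => mul_nonneg (ih _ _) (hM _ _ _)

end Prod

/-! ### Polyhedral cones and contracting blocks -/

section Cone

variable {d : ℕ} {ι : Type*}

/-- The cone of the nonnegative vectors at which all the rows of `B` are nonnegative. -/
def polyCone (B : Matrix ι (Fin d) ℝ) : Set (Fin d → ℝ) := {x | 0 ≤ x ∧ 0 ≤ B.mulVec x}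

/-- The nonzero vectors of `polyCone B`. -/
def polyCone' (B : Matrix ι (Fin d) ℝ) : Set (Fin d → ℝ) := {x | x ∈ polyCone B ∧ x ≠ 0}

variable {B : Matrix ι (Fin d) ℝ}

lemma polyCone_add {x y : Fin d → ℝ} (hx : x ∈ polyCone B) (hy : y ∈ polyCone B) :
    x + y ∈ polyCone B :=
  ⟨add_nonneg hx.1 hy.1, by rw [Matrix.mulVec_add]; exact add_nonneg hx.2 hy.2⟩

lemma polyCone_smul {a : ℝ} (ha : 0 ≤ a) {x : Fin d → ℝ} (hx : x ∈ polyCone B) :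
    a • x ∈ polyCone B :=
  ⟨smul_nonneg ha hx.1, by rw [Matrix.mulVec_smul]; exact smul_nonneg ha hx.2⟩

lemma normalized_mem_polyCone {x : Fin d → ℝ} (hx : x ∈ polyCone B) :
    normalized x ∈ polyCone B :=
  polyCone_smul (inv_nonneg.2 (l1norm_nonneg x)) hx

lemma isClosed_polyCone : IsClosed (polyCone B) := by
  have h : Continuous fun x : Fin d → ℝ => B.mulVec x := by fun_prop
  exact (isClosed_le continuous_const continuous_id).inter (isClosed_le continuous_const h)

/-- A homogeneous function that is continuous and positive on the nonzero vectors of the cone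
dominates a multiple of the norm. -/
lemma exists_mul_l1norm_le {φ : (Fin d → ℝ) → ℝ} (hφ : Continuous φ)
    (hs : ∀ (a : ℝ) x, φ (a • x) = a * φ x) (hpos : ∀ x ∈ polyCone' B, 0 < φ x) :
    ∃ m : ℝ, 0 < m ∧ ∀ x ∈ polyCone B, m * l1norm x ≤ φ x := by
  have hcl : IsClosed (polyCone B ∩ {x | l1norm x = 1}) :=
    isClosed_polyCone.inter (isClosed_eq continuous_l1norm continuous_const)
  have hcomp : IsCompact (polyCone B ∩ {x | l1norm x = 1}) := by
    refine Metric.isCompact_of_isClosed_isBounded hcl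
      ((Metric.isBounded_closedBall (x := (0 : Fin d → ℝ)) (r := 1)).subset fun x hx => ?_)
    rw [mem_closedBall_zero_iff, pi_norm_le_iff_of_nonneg zero_le_one]
    exact fun i => (abs_le_l1norm x i).trans_eq hx.2
  have key : ∃ m : ℝ, 0 < m ∧ ∀ x ∈ polyCone B ∩ {x | l1norm x = 1}, m ≤ φ x := by
    rcases (polyCone B ∩ {x | l1norm x = 1}).eq_empty_or_nonempty with h | h
    · exact ⟨1, one_pos, by simp [h]⟩
    · obtain ⟨y, hy, hmin⟩ := hcomp.exists_isMinOn h hφ.continuousOn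
      refine ⟨φ y, hpos y ⟨hy.1, ?_⟩, fun x hx => hmin hx⟩
      rintro rfl
      simpa using hy.2
  obtain ⟨m, hm, h⟩ := key
  refine ⟨m, hm, fun x hx => ?_⟩
  rcases eq_or_ne x 0 with rfl | hx0
  · have := hs 0 0
    simp only [zero_mul, smul_zero] at this
    simp [this]
  · have h1 := h (normalized x) ⟨normalized_mem_polyCone hx, l1norm_normalized hx0⟩
    have h2 := hs (l1norm x) (normalized x)
    rw [l1norm_smul_normalized] at h2
    rw [h2, mul_comm]
    exact mul_le_mul_of_nonneg_left h1 (l1norm_nonneg x)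

lemma exists_mul_l1norm_le_mulVec [Finite ι] {κ : Type*} [Finite κ] {C : Matrix κ (Fin d) ℝ}
    (h : ∀ k, (∀ x ∈ polyCone' B, 0 < C.mulVec x k) ∨ ∀ x, C.mulVec x k = 0) :
    ∃ m : ℝ, 0 < m ∧ ∀ k, (∀ x, C.mulVec x k = 0) ∨
      ∀ x ∈ polyCone B, m * l1norm x ≤ C.mulVec x k := by
  have h1 : ∀ k, ∃ m : ℝ, 0 < m ∧ ((∀ x, C.mulVec x k = 0) ∨
      ∀ x ∈ polyCone B, m * l1norm x ≤ C.mulVec x k) := by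
    intro k
    rcases h k with h | h
    · obtain ⟨m, hm, h'⟩ := exists_mul_l1norm_le (B := B) (φ := fun x => C.mulVec x k)
        (by fun_prop) (fun a x => by rw [Matrix.mulVec_smul]; rfl) h
      exact ⟨m, hm, Or.inr h'⟩
    · exact ⟨1, one_pos, Or.inl h⟩
  choose m hm h2 using h1
  cases nonempty_fintype κ
  rcases isEmpty_or_nonempty κ with hκ | hκ
  · exact ⟨1, one_pos, fun k => hκ.elim k⟩
  · obtain ⟨k0, hk0⟩ := Finite.exists_min m
    refine ⟨m k0, hm k0, fun k => (h2 k).imp id fun h x hx => le_trans ?_ (h x hx)⟩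
    exact mul_le_mul_of_nonneg_right (hk0 k) (l1norm_nonneg x)

/-- `Q` is contracting on `polyCone B`: up to bounded factors, it maps the nonzero vectors of the
cone to the multiples of one vector of the cone. -/
def IsContracting (B : Matrix ι (Fin d) ℝ) (Q : Matrix (Fin d) (Fin d) ℝ) : Prop :=
  ∃ u ∈ polyCone' B, ∃ m C : ℝ, 0 < m ∧ 0 < C ∧ ∀ x ∈ polyCone B,
    Q.mulVec x - (m * l1norm x) • u ∈ polyCone B ∧ ∀ i, Q.mulVec x i ≤ C * l1norm x * u i

/-- By compactness, a coordinate or form that is positive on the nonzero cone dominates a multiple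
of the norm. The witness is `u = Q h`; coordinates that vanish identically on the image also vanish
at `u`, so they impose no constraint. -/
lemma isContracting_of_pos [Finite ι] {Q : Matrix (Fin d) (Fin d) ℝ} {h : Fin d → ℝ}
    (hh : h ∈ polyCone' B) (hQ0 : ∀ x ∈ polyCone' B, Q.mulVec x ∈ polyCone' B)
    (h1 : ∀ i, (∀ x ∈ polyCone' B, 0 < Q.mulVec x i) ∨ ∀ x, Q.mulVec x i = 0)
    (h2 : ∀ k, (∀ x ∈ polyCone' B, 0 < (B * Q).mulVec x k) ∨ ∀ x, (B * Q).mulVec x k = 0) :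
    IsContracting B Q := by
  cases nonempty_fintype ι
  obtain ⟨m1, hm1, H1⟩ := exists_mul_l1norm_le_mulVec h1
  obtain ⟨m2, hm2, H2⟩ := exists_mul_l1norm_le_mulVec h2
  set u := Q.mulVec h with hu
  have hub : ∀ x, B.mulVec (Q.mulVec x) = (B * Q).mulVec x := fun x => by
    rw [Matrix.mulVec_mulVec]
  set T : ℝ := ∑ i, |u i| + ∑ k, |(B.mulVec u) k| with hT
  have hT1 : ∀ i, u i ≤ T := fun i => (le_abs_self _).trans <|
    (Finset.single_le_sum (f := fun i => |u i|) (fun _ _ => abs_nonneg _)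
      (Finset.mem_univ i)).trans (le_add_of_nonneg_right (Finset.sum_nonneg fun _ _ => abs_nonneg _))
  have hT2 : ∀ k, (B.mulVec u) k ≤ T := fun k => (le_abs_self _).trans <|
    (Finset.single_le_sum (f := fun k => |(B.mulVec u) k|) (fun _ _ => abs_nonneg _)
      (Finset.mem_univ k)).trans (le_add_of_nonneg_left (Finset.sum_nonneg fun _ _ => abs_nonneg _))
  have hT0 : 0 ≤ T := by positivity
  -- `T` bounds all coordinates and forms of `u`, so `m T ≤ min m1 m2` and subtracting `m ‖x‖ u`
  -- from `Q x` does not leave the cone. The `+ 1` avoids division by zero.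
  set m := min m1 m2 / (T + 1) with hm
  have hm0 : 0 < m := div_pos (lt_min hm1 hm2) (by positivity)
  have hmT : m * T ≤ min m1 m2 := by
    rw [hm, div_mul_eq_mul_div, div_le_iff₀ (by positivity)]
    exact mul_le_mul_of_nonneg_left (by linarith) (lt_min hm1 hm2).le
  set R : ℝ := ∑ i, ∑ j, |Q i j| with hR
  have hs : 0 < l1norm h := l1norm_pos hh.2
  have hQle : ∀ x : Fin d → ℝ, ∀ i, Q.mulVec x i ≤ R * l1norm x := by
    intro x i
    calc Q.mulVec x i = ∑ j, Q i j * x j := rfl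
      _ ≤ ∑ j, |Q i j| * l1norm x := Finset.sum_le_sum fun j _ => (le_abs_self _).trans <| by
          rw [abs_mul]
          exact mul_le_mul_of_nonneg_left (abs_le_l1norm x j) (abs_nonneg _)
      _ = (∑ j, |Q i j|) * l1norm x := (Finset.sum_mul ..).symm
      _ ≤ R * l1norm x := mul_le_mul_of_nonneg_right
          (Finset.single_le_sum (f := fun i => ∑ j, |Q i j|)
            (fun _ _ => Finset.sum_nonneg fun _ _ => abs_nonneg _) (Finset.mem_univ i))
          (l1norm_nonneg x)
  have hR0 : 0 ≤ R := Finset.sum_nonneg fun _ _ => Finset.sum_nonneg fun _ _ => abs_nonneg _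
  refine ⟨u, hQ0 h hh, m, (R + 1) / (m1 * l1norm h), hm0, by positivity, fun x hx => ⟨⟨?_, ?_⟩, ?_⟩⟩
  · intro i
    have hx0 := l1norm_nonneg x
    rcases H1 i with H | H
    · simp [hu, H]
    · have e1 : m * l1norm x * u i ≤ m1 * l1norm x :=
        calc m * l1norm x * u i ≤ m * l1norm x * T := by gcongr; exact hT1 i
          _ = (m * T) * l1norm x := by ring
          _ ≤ m1 * l1norm x := by gcongr; exact hmT.trans (min_le_left _ _)
      have := H x hx
      simp only [Pi.zero_apply, Pi.sub_apply, Pi.smul_apply, smul_eq_mul]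
      linarith
  · intro k
    have hx0 := l1norm_nonneg x
    rw [Matrix.mulVec_sub, Matrix.mulVec_smul]
    simp only [Pi.zero_apply, Pi.sub_apply, Pi.smul_apply, smul_eq_mul]
    rcases H2 k with H | H
    · rw [hu, hub, hub, H, H]; simp
    · have e1 : m * l1norm x * (B.mulVec u) k ≤ m2 * l1norm x :=
        calc m * l1norm x * (B.mulVec u) k ≤ m * l1norm x * T := by gcongr; exact hT2 k
          _ = (m * T) * l1norm x := by ring
          _ ≤ m2 * l1norm x := by gcongr; exact hmT.trans (min_le_right _ _)
      have := H x hx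
      rw [hub]
      linarith
  · intro i
    rcases H1 i with H | H
    · simp [hu, H]
    · have e1 := H h hh.1
      have e2 := hQle x i
      have hx0 := l1norm_nonneg x
      calc Q.mulVec x i ≤ (R + 1) * l1norm x := by nlinarith
        _ = (R + 1) / (m1 * l1norm h) * l1norm x * (m1 * l1norm h) := by field_simp
        _ ≤ (R + 1) / (m1 * l1norm h) * l1norm x * u i := by gcongr

/-- The images by `P` of the nonzero vectors of the cone have, once normalized, coordinates that
differ by at most `δ`. -/
def OscLE (B : Matrix ι (Fin d) ℝ) (P : Matrix (Fin d) (Fin d) ℝ) (δ : ℝ) : Prop :=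
  ∀ x ∈ polyCone' B, ∀ y ∈ polyCone' B, ∀ i,
    normalized (P.mulVec x) i - normalized (P.mulVec y) i ≤ δ

lemma mulVec_mono {P : Matrix (Fin d) (Fin d) ℝ} (hP : ∀ i j, 0 ≤ P i j) {x y : Fin d → ℝ}
    (h : x ≤ y) : P.mulVec x ≤ P.mulVec y := fun i => by
  simp only [Matrix.mulVec, dotProduct]
  exact Finset.sum_le_sum fun j _ => mul_le_mul_of_nonneg_left (h j) (hP i j)

lemma mulVec_nonneg {P : Matrix (Fin d) (Fin d) ℝ} (hP : ∀ i j, 0 ≤ P i j) {x : Fin d → ℝ}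
    (h : 0 ≤ x) : 0 ≤ P.mulVec x := fun i => by
  simp only [Matrix.mulVec, dotProduct]
  exact Finset.sum_nonneg fun j _ => mul_nonneg (hP i j) (h j)

lemma l1norm_mono {x y : Fin d → ℝ} (hx : 0 ≤ x) (h : x ≤ y) : l1norm x ≤ l1norm y := by
  rw [l1norm_of_nonneg hx, l1norm_of_nonneg (hx.trans h)]
  exact Finset.sum_le_sum fun i _ => h i

lemma oscLE_two (P : Matrix (Fin d) (Fin d) ℝ) : OscLE B P 2 := fun x _ y _ i => by
  have h1 := abs_le.1 (normalized_le_one (P.mulVec x) i)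
  have h2 := abs_le.1 (normalized_le_one (P.mulVec y) i)
  linarith

/-- Right multiplication by a matrix that preserves the cone only shrinks the set of vectors being
compared. Hence the letters between two contracting blocks do no harm. -/
lemma OscLE.mul {P Q : Matrix (Fin d) (Fin d) ℝ} {δ : ℝ} (h : OscLE B P δ)
    (hQ : ∀ x ∈ polyCone' B, Q.mulVec x ∈ polyCone' B) : OscLE B (P * Q) δ :=
  fun x hx y hy i => by
    rw [← Matrix.mulVec_mulVec, ← Matrix.mulVec_mulVec]
    exact h _ (hQ x hx) _ (hQ y hy) i

/-- Multiplying on the right by a contracting block divides the oscillation. -/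
lemma IsContracting.exists_oscLE {Q : Matrix (Fin d) (Fin d) ℝ} (hQ : IsContracting B Q)
    (hQ0 : ∀ x ∈ polyCone' B, Q.mulVec x ∈ polyCone' B) :
    ∃ θ : ℝ, 0 < θ ∧ θ < 1 ∧ ∀ (P : Matrix (Fin d) (Fin d) ℝ) (δ : ℝ), (∀ i j, 0 ≤ P i j) →
      (∀ x ∈ polyCone' B, P.mulVec x ≠ 0) → OscLE B P δ → OscLE B (P * Q) ((1 - θ) * δ) := by
  obtain ⟨u, hu, m, C, hm, hC, H⟩ := hQ
  -- The bound `m / C` keeps the remainder `z` below in the cone; the bound `1 / 2` keeps `1 - θ`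
  -- positive.
  set θ := min (m / C) (1 / 2) with hθ
  have hθ0 : 0 < θ := lt_min (by positivity) (by norm_num)
  have hθ1 : θ < 1 := (min_le_right _ _).trans_lt (by norm_num)
  have hθm : θ * C ≤ m := by
    calc θ * C ≤ m / C * C := by gcongr; exact min_le_left _ _
      _ = m := by field_simp
  refine ⟨θ, hθ0, hθ1, fun P δ hP hP0 hosc => ?_⟩
  have hPu : 0 < l1norm (P.mulVec u) := l1norm_pos (hP0 u hu)
  have key : ∀ x ∈ polyCone' B, ∃ z ∈ polyCone' B, ∀ i, normalized ((P * Q).mulVec x) i =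
      θ * normalized (P.mulVec u) i + (1 - θ) * normalized (P.mulVec z) i := by
    intro x hx
    obtain ⟨H1, H2⟩ := H x hx.1
    set q := Q.mulVec x with hq
    have hqK := hQ0 x hx
    have hPq : 0 < l1norm (P.mulVec q) := l1norm_pos (hP0 q hqK)
    -- This `τ` makes `P (τ u)` carry exactly the fraction `θ` of the norm of `P q`. The norm is
    -- additive on nonnegative vectors, so normalizing gives a convex combination whose weight `θ`
    -- is the same for all `x`; the common term cancels in differences.
    set τ := θ * l1norm (P.mulVec q) / l1norm (P.mulVec u) with hτ
    have hx0 := l1norm_nonneg x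
    have hτle : τ ≤ m * l1norm x := by
      have e : l1norm (P.mulVec q) ≤ C * l1norm x * l1norm (P.mulVec u) := by
        have h1 : q ≤ (C * l1norm x) • u := fun i => H2 i
        have h2 := mulVec_mono hP h1
        rw [Matrix.mulVec_smul] at h2
        have h3 := l1norm_mono (mulVec_nonneg hP hqK.1.1) h2
        rwa [l1norm_smul, abs_of_nonneg (by positivity)] at h3
      rw [hτ, div_le_iff₀ hPu]
      calc θ * l1norm (P.mulVec q) ≤ θ * (C * l1norm x * l1norm (P.mulVec u)) := by gcongr
        _ = (θ * C) * (l1norm x * l1norm (P.mulVec u)) := by ring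
        _ ≤ m * (l1norm x * l1norm (P.mulVec u)) := by gcongr
        _ = _ := by ring
    set z := q - τ • u with hz
    have hzK : z ∈ polyCone B := by
      have : z = (q - (m * l1norm x) • u) + (m * l1norm x - τ) • u := by
        rw [hz, sub_smul]; abel
      rw [this]
      exact polyCone_add H1 (polyCone_smul (sub_nonneg.2 hτle) hu.1)
    have hPqz : P.mulVec q = P.mulVec z + τ • P.mulVec u := by
      rw [hz, Matrix.mulVec_sub, Matrix.mulVec_smul]; abel
    have hτ0 : 0 < τ := by positivity
    have hnorm : l1norm (P.mulVec z) = (1 - θ) * l1norm (P.mulVec q) := by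
      have h1 := congrArg l1norm hPqz
      rw [l1norm_add_of_nonneg (mulVec_nonneg hP hzK.1)
        (smul_nonneg hτ0.le (mulVec_nonneg hP hu.1.1)), l1norm_smul, abs_of_pos hτ0] at h1
      have h2 : τ * l1norm (P.mulVec u) = θ * l1norm (P.mulVec q) := by
        rw [hτ]; field_simp
      linarith
    have hz0 : z ≠ 0 := by
      intro h0
      rw [h0, Matrix.mulVec_zero, l1norm_zero] at hnorm
      have : 0 < (1 - θ) * l1norm (P.mulVec q) := mul_pos (by linarith) hPq
      linarith
    refine ⟨z, ⟨hzK, hz0⟩, fun i => ?_⟩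
    rw [← Matrix.mulVec_mulVec, ← hq]
    simp only [normalized, Pi.smul_apply, smul_eq_mul]
    rw [hnorm, congrFun hPqz i]
    simp only [Pi.add_apply, Pi.smul_apply, smul_eq_mul, hτ]
    have : (1 - θ) ≠ 0 := by linarith
    field_simp
    ring
  intro x hx y hy i
  obtain ⟨z, hz, e1⟩ := key x hx
  obtain ⟨w, hw, e2⟩ := key y hy
  rw [e1, e2]
  have := mul_le_mul_of_nonneg_left (hosc z hz w hw i) (by linarith : 0 ≤ 1 - θ)
  linarith

/-- If contracting blocks taken from a finite set appear infinitely often in `ω`, the oscillation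
of the prefix products tends to `0`. -/
lemma exists_oscLE_prefixProd {b : ℕ} {M : Fin b → Matrix (Fin d) (Fin d) ℝ}
    (hM : ∀ a i j, 0 ≤ M a i j)
    (hK : ∀ a, ∀ x ∈ polyCone' B, (M a).mulVec x ∈ polyCone' B)
    (𝒬 : Set (Matrix (Fin d) (Fin d) ℝ)) (hfin : 𝒬.Finite) (hne : 𝒬.Nonempty)
    (h𝒬 : ∀ Q ∈ 𝒬, IsContracting B Q ∧ ∀ x ∈ polyCone' B, Q.mulVec x ∈ polyCone' B)
    {ω : ℕ → Fin b} (hω : ∀ N, ∃ n ≥ N, ∃ L, prefixProd M (shift n ω) L ∈ 𝒬)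
    {ε : ℝ} (hε : 0 < ε) : ∃ n, OscLE B (prefixProd M ω n) ε := by
  have h1 : ∀ Q : 𝒬, ∃ θ : ℝ, 0 < θ ∧ θ < 1 ∧ ∀ (P : Matrix (Fin d) (Fin d) ℝ) (δ : ℝ),
      (∀ i j, 0 ≤ P i j) → (∀ x ∈ polyCone' B, P.mulVec x ≠ 0) → OscLE B P δ →
      OscLE B (P * Q) ((1 - θ) * δ) := fun Q =>
    (h𝒬 Q Q.2).1.exists_oscLE (h𝒬 Q Q.2).2
  choose θ hθ0 hθ1 hθ using h1
  have := hfin.to_subtype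
  have := hne.to_subtype
  obtain ⟨Q0, hQ0⟩ := Finite.exists_min θ
  set ρ := 1 - θ Q0 with hρ
  have hρ0 : 0 < ρ := by have := hθ1 Q0; linarith
  have hρ1 : ρ < 1 := by have := hθ0 Q0; linarith
  have step : ∀ j : ℕ, ∃ n, OscLE B (prefixProd M ω n) (ρ ^ j * 2) := by
    intro j
    induction j with
    | zero => exact ⟨0, by simpa using oscLE_two _⟩
    | succ j ih =>
      obtain ⟨n, hn⟩ := ih
      obtain ⟨n', hn', L, hL⟩ := hω n
      obtain ⟨k, rfl⟩ := Nat.exists_eq_add_of_le hn'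
      have e1 : OscLE B (prefixProd M ω (n + k)) (ρ ^ j * 2) := by
        rw [prefixProd_add]
        exact hn.mul (prefixProd_invariant M hK _ _)
      have e2 := hθ ⟨_, hL⟩ _ _ (prefixProd_nonneg M hM ω (n + k))
        (fun x hx => (prefixProd_invariant M hK _ _ x hx).2) e1
      refine ⟨n + k + L, ?_⟩
      rw [prefixProd_add]
      intro x hx y hy i
      refine (e2 x hx y hy i).trans ?_
      rw [pow_succ']
      have h3 : (1 - θ ⟨_, hL⟩) ≤ ρ := by have := hQ0 ⟨_, hL⟩; linarith
      calc (1 - θ ⟨_, hL⟩) * (ρ ^ j * 2) ≤ ρ * (ρ ^ j * 2) := by gcongr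
        _ = _ := by ring
  obtain ⟨j, hj⟩ := exists_pow_lt_of_lt_one (half_pos hε) hρ1
  obtain ⟨n, hn⟩ := step j
  exact ⟨n, fun x hx y hy i => (hn x hx y hy i).trans (by linarith)⟩

end Cone

/-! ### From local to uniform convergence -/

/-- Finitely many of the cylinders cover the compact space of sequences, and the largest of their
lengths serves for all sequences. -/
lemma exists_tendstoUniformly_of_local {b d : ℕ} (F : ℕ → (ℕ → Fin b) → Fin d → ℝ)
    (h : ∀ ω, ∀ ε > 0, ∃ n, ∀ η ∈ PiNat.cylinder ω n, ∀ m ≥ n, ∀ m' ≥ n,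
      dist (F m η) (F m' η) ≤ ε) :
    ∃ l : (ℕ → Fin b) → Fin d → ℝ, TendstoUniformly F l atTop := by
  have hlim : ∀ ω, ∃ y, Tendsto (fun n => F n ω) atTop (𝓝 y) := by
    intro ω
    refine cauchySeq_tendsto_of_complete (Metric.cauchySeq_iff.2 fun ε hε => ?_)
    obtain ⟨n, hn⟩ := h ω (ε / 2) (half_pos hε)
    exact ⟨n, fun m hm m' hm' =>
      (hn ω (PiNat.self_mem_cylinder ω n) m hm m' hm').trans_lt (half_lt_self hε)⟩
  choose l hl using hlim
  refine ⟨l, Metric.tendstoUniformly_iff.2 fun ε hε => ?_⟩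
  choose n hn using fun ω => h ω (ε / 2) (half_pos hε)
  obtain ⟨t, ht⟩ := isCompact_univ.elim_finite_subcover (fun ω => PiNat.cylinder ω (n ω))
    (fun ω => PiNat.isOpen_cylinder (E := fun _ => Fin b) ω (n ω))
    (fun ω _ => mem_iUnion.2 ⟨ω, PiNat.self_mem_cylinder ω _⟩)
  filter_upwards [eventually_ge_atTop (t.sup n)] with m hm η
  obtain ⟨ω, hω, hη⟩ := mem_iUnion₂.1 (ht (mem_univ η))
  have hmn : n ω ≤ m := (Finset.le_sup hω).trans hm
  have : dist (l η) (F m η) ≤ ε / 2 :=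
    le_of_tendsto ((hl η).dist tendsto_const_nhds)
      (eventually_atTop.2 ⟨n ω, fun m' hm' => hn ω η hη m' hm' m hmn⟩)
  exact this.trans_lt (half_lt_self hε)


/-! ### An invariant cone for `M₀, M₁, M₂` -/

lemma M₀_mulVec (x : Fin 7 → ℝ) :
    M₀.mulVec x = ![x 0, x 2, x 3 + x 4, 0, x 0 + x 6, x 4, x 1] := by
  ext i; fin_cases i <;> simp [M₀, Matrix.mulVec, dotProduct, Fin.sum_univ_succ]

lemma M₁_mulVec (x : Fin 7 → ℝ) :
    M₁.mulVec x = ![x 2 + x 3, x 5, x 3 + x 4, x 0, x 2, 0, 0] := by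
  ext i; fin_cases i <;> simp [M₁, Matrix.mulVec, dotProduct, Fin.sum_univ_succ]

lemma M₂_mulVec (e : ℝ) (x : Fin 7 → ℝ) :
    (M₂ e).mulVec x = ![x 0 + x 4 + x 6, 0, x 0 + x 6, x 3 + x 4, x 4, e * x 4, 0] := by
  ext i; fin_cases i <;> simp [M₂, Matrix.mulVec, dotProduct, Fin.sum_univ_succ, add_assoc]

/-- The linear forms that cut out, together with the coordinates, an invariant cone. -/
def coneForms (t : ℝ) : Matrix (Fin 17) (Fin 7) ℝ :=
  !![t, 0, 0, -1, 0, 0, 0;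
     -1, 0, 0, 4 * t, t, 0, -1;
     0, 0, 16 * t, -1, -1, 0, 0;
     -1, 0, t, t, 0, 0, 0;
     t - 1, -1, 0, 0, 0, 0, t;
     -1, 0, -1, 16 * t, 16 * t, 0, 0;
     -1, 0, 0, t, t, 0, 0;
     t - 1, t, -1, 0, 0, 0, 0;
     0, 0, t - 1, t - 1, 0, -1, 0;
     t - 1, 0, t, -1, -1, 0, 0;
     0, 0, t - 1, t - 2, -1, t, 0;
     t - 2, 0, 0, t, t, 0, -1;
     -1, 0, 0, t - 1, 2 * t - 1, 0, -1;
     t - 2, 0, -1, t - 1, t - 1, 0, 0;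
     2 * t - 3, 0, 0, -1, -1, 0, t - 1;
     2 * t - 4, t - 1, 0, 0, 0, 0, -1;
     2 * t - 4, -1, t - 1, 0, 0, 0, 0]

lemma coneForms_mulVec (t : ℝ) (x : Fin 7 → ℝ) :
    (coneForms t).mulVec x =
      ![t * x 0 - x 3,
        4 * (t * x 3) + t * x 4 - x 0 - x 6,
        16 * (t * x 2) - x 3 - x 4,
        t * x 2 + t * x 3 - x 0,
        t * x 0 - x 0 + t * x 6 - x 1,
        16 * (t * x 3) + 16 * (t * x 4) - x 0 - x 2,
        t * x 3 + t * x 4 - x 0,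
        t * x 0 - x 0 + t * x 1 - x 2,
        t * x 2 - x 2 + t * x 3 - x 3 - x 5,
        t * x 0 - x 0 + t * x 2 - x 3 - x 4,
        t * x 2 - x 2 + t * x 3 - 2 * x 3 - x 4 + t * x 5,
        t * x 0 - 2 * x 0 + t * x 3 + t * x 4 - x 6,
        t * x 3 - x 3 + 2 * (t * x 4) - x 4 - x 0 - x 6,
        t * x 0 - 2 * x 0 + t * x 3 - x 3 + t * x 4 - x 4 - x 2,
        2 * (t * x 0) - 3 * x 0 + t * x 6 - x 6 - x 3 - x 4,
        2 * (t * x 0) - 4 * x 0 + t * x 1 - x 1 - x 6,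
        2 * (t * x 0) - 4 * x 0 + t * x 2 - x 2 - x 1] := by
  ext i
  fin_cases i <;> simp [coneForms, Matrix.mulVec, dotProduct, Fin.sum_univ_succ] <;> ring

lemma mem_cone_iff {t : ℝ} {x : Fin 7 → ℝ} : x ∈ polyCone (coneForms t) ↔
    (∀ i, 0 ≤ x i) ∧ ∀ k, 0 ≤ (coneForms t).mulVec x k := Iff.rfl

/-- The inequalities satisfied by a vector `x` of the cone, together with `10 x_i ≤ t x_i`. -/
lemma cone_facts {t : ℝ} (ht : 10 ≤ t) {x : Fin 7 → ℝ} (hx : x ∈ polyCone (coneForms t)) :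
    ((0 ≤ x 0 ∧ 0 ≤ x 1 ∧ 0 ≤ x 2 ∧ 0 ≤ x 3 ∧ 0 ≤ x 4 ∧ 0 ≤ x 5 ∧ 0 ≤ x 6) ∧
      10 * x 0 ≤ t * x 0 ∧ 10 * x 1 ≤ t * x 1 ∧ 10 * x 2 ≤ t * x 2 ∧ 10 * x 3 ≤ t * x 3 ∧
      10 * x 4 ≤ t * x 4 ∧ 10 * x 5 ≤ t * x 5 ∧ 10 * x 6 ≤ t * x 6) ∧
    0 ≤ t * x 0 - x 3 ∧
    0 ≤ 4 * (t * x 3) + t * x 4 - x 0 - x 6 ∧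
    0 ≤ 16 * (t * x 2) - x 3 - x 4 ∧
    0 ≤ t * x 2 + t * x 3 - x 0 ∧
    0 ≤ t * x 0 - x 0 + t * x 6 - x 1 ∧
    0 ≤ 16 * (t * x 3) + 16 * (t * x 4) - x 0 - x 2 ∧
    0 ≤ t * x 3 + t * x 4 - x 0 ∧
    0 ≤ t * x 0 - x 0 + t * x 1 - x 2 ∧
    0 ≤ t * x 2 - x 2 + t * x 3 - x 3 - x 5 ∧
    0 ≤ t * x 0 - x 0 + t * x 2 - x 3 - x 4 ∧
    0 ≤ t * x 2 - x 2 + t * x 3 - 2 * x 3 - x 4 + t * x 5 ∧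
    0 ≤ t * x 0 - 2 * x 0 + t * x 3 + t * x 4 - x 6 ∧
    0 ≤ t * x 3 - x 3 + 2 * (t * x 4) - x 4 - x 0 - x 6 ∧
    0 ≤ t * x 0 - 2 * x 0 + t * x 3 - x 3 + t * x 4 - x 4 - x 2 ∧
    0 ≤ 2 * (t * x 0) - 3 * x 0 + t * x 6 - x 6 - x 3 - x 4 ∧
    0 ≤ 2 * (t * x 0) - 4 * x 0 + t * x 1 - x 1 - x 6 ∧
    0 ≤ 2 * (t * x 0) - 4 * x 0 + t * x 2 - x 2 - x 1 := by
  obtain ⟨h0, h⟩ := mem_cone_iff.1 hx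
  -- The products `t * x i` are treated as separate unknowns, so that everything proved from these
  -- facts is linear; this inequality is how `10 ≤ t` enters.
  have hT : ∀ i, 10 * x i ≤ t * x i := fun i => mul_le_mul_of_nonneg_right ht (h0 i)
  rw [coneForms_mulVec] at h
  exact ⟨⟨⟨h0 0, h0 1, h0 2, h0 3, h0 4, h0 5, h0 6⟩,
    hT 0, hT 1, hT 2, hT 3, hT 4, hT 5, hT 6⟩,
    h 0, h 1, h 2, h 3, h 4, h 5, h 6, h 7, h 8, h 9, h 10, h 11, h 12, h 13, h 14, h 15, h 16⟩

/-- Each form or coordinate evaluated at the image is bounded below by a nonnegative combination of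
the forms and coordinates at `x` and of the inequalities `10 * x i ≤ t * x i`. The system of forms
is closed under the three matrices in this sense, with the same `t` on both sides. -/
lemma matrices_mulVec_mem_cone {e t : ℝ} (he : e = 0 ∨ e = 1) (ht : 10 ≤ t) (a : Fin 3)
    {x : Fin 7 → ℝ} (hx : x ∈ polyCone (coneForms t)) :
    (matrices e a).mulVec x ∈ polyCone (coneForms t) := by
  obtain ⟨⟨⟨p0, p1, p2, p3, p4, p5, p6⟩, q0, q1, q2, q3, q4, q5, q6⟩, f0, f1, f2, f3, f4, f5, f6,
    f7, f8, f9, f10, f11, f12, f13, f14, f15, f16⟩ := cone_facts ht hx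
  rw [mem_cone_iff, coneForms_mulVec]
  fin_cases a
  · simp only [matrices, Fin.zero_eta, Matrix.cons_val_zero, M₀_mulVec]
    constructor <;> intro i <;> fin_cases i <;> simp <;> linarith
  · simp only [matrices, Fin.mk_one, Matrix.cons_val_one, Matrix.cons_val_zero, M₁_mulVec]
    constructor <;> intro i <;> fin_cases i <;> simp <;> linarith
  · simp only [matrices, Fin.reduceFinMk, Matrix.cons_val, M₂_mulVec]
    rcases he with rfl | rfl <;>
    constructor <;> intro i <;> fin_cases i <;> simp <;> linarith


/-- The forms propagate zeros: if `x 2 = 0`, then `x 3` and `x 4` vanish, then `x 0`, and finally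
all the others. The remaining sums are positive because their vanishing would force `x 2 = 0`. These
are the quantities through which positivity of products is tested. -/
lemma cone_pos {t : ℝ} (ht : 10 ≤ t) {x : Fin 7 → ℝ} (hx : x ∈ polyCone' (coneForms t)) :
    0 < x 2 ∧ 0 < x 0 + x 1 ∧ 0 < x 0 + x 4 ∧ 0 < x 0 + x 6 ∧ 0 < x 3 + x 4 := by
  obtain ⟨⟨⟨p0, p1, p2, p3, p4, p5, p6⟩, q0, q1, q2, q3, q4, q5, q6⟩, f0, f1, f2, f3, f4, f5, f6,
    f7, f8, f9, f10, f11, f12, f13, f14, f15, f16⟩ := cone_facts ht hx.1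
  have h2 : 0 < x 2 := by
    by_contra! h
    have z2 : x 2 = 0 := le_antisymm h p2
    have z3 : x 3 = 0 := by rw [z2] at f2; linarith
    have z4 : x 4 = 0 := by rw [z2] at f2; linarith
    have z0 : x 0 = 0 := by rw [z2, z3] at f3; linarith
    have z6 : x 6 = 0 := by rw [z3, z4] at f1; linarith
    have z1 : x 1 = 0 := by rw [z0, z6] at f4; linarith
    have z5 : x 5 = 0 := by rw [z2, z3] at f8; linarith
    refine hx.2 (funext fun i => ?_)
    fin_cases i <;> assumption
  have h01 : 0 < x 0 + x 1 := by
    by_contra! h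
    have z0 : x 0 = 0 := by linarith
    have z1 : x 1 = 0 := by linarith
    rw [z0, z1] at f7; linarith
  have h04 : 0 < x 0 + x 4 := by
    by_contra! h
    have z0 : x 0 = 0 := by linarith
    have z4 : x 4 = 0 := by linarith
    have z3 : x 3 = 0 := by rw [z0] at f0; linarith
    rw [z0, z3, z4] at f13; linarith
  have h06 : 0 < x 0 + x 6 := by
    by_contra! h
    have z0 : x 0 = 0 := by linarith
    have z6 : x 6 = 0 := by linarith
    have z1 : x 1 = 0 := by rw [z0, z6] at f4; linarith
    linarith
  refine ⟨h2, h01, h04, h06, ?_⟩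
  by_contra! h
  have z3 : x 3 = 0 := by linarith
  have z4 : x 4 = 0 := by linarith
  have z0 : x 0 = 0 := by rw [z3, z4] at f6; linarith
  linarith

lemma matrices_mulVec_mem_cone' {e t : ℝ} (he : e = 0 ∨ e = 1) (ht : 10 ≤ t) (a : Fin 3)
    {x : Fin 7 → ℝ} (hx : x ∈ polyCone' (coneForms t)) :
    (matrices e a).mulVec x ∈ polyCone' (coneForms t) := by
  refine ⟨matrices_mulVec_mem_cone he ht a hx.1, fun h => ?_⟩
  obtain ⟨h2, -, h04, h06, h34⟩ := cone_pos ht hx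
  -- Coordinate 2 of the image is `x 3 + x 4` for the first two matrices and `x 0 + x 6` for the
  -- third, both positive.
  have h2 := congrFun h 2
  fin_cases a
  · simp [matrices, M₀_mulVec] at h2
    linarith
  · simp [matrices, M₁_mulVec] at h2
    linarith
  · simp [matrices, M₂_mulVec] at h2
    linarith

lemma matrices_nonneg {e : ℝ} (he : 0 ≤ e) (a : Fin 3) (i j : Fin 7) : 0 ≤ matrices e a i j := by
  have h : ∀ x : Fin 7 → ℝ, 0 ≤ x → 0 ≤ (matrices e a).mulVec x := by
    intro x hx i
    have p : ∀ i, 0 ≤ x i := hx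
    have := p 0; have := p 1; have := p 2; have := p 3; have := p 4; have := p 5; have := p 6
    have : 0 ≤ e * x 4 := by positivity
    fin_cases a <;> simp only [matrices, Fin.zero_eta, Fin.mk_one, Fin.reduceFinMk,
      Matrix.cons_val, M₀_mulVec, M₁_mulVec, M₂_mulVec] <;>
    fin_cases i <;> simp <;> linarith
  have := h (Pi.single j 1) (by simp) i
  simpa using this

/-- A positive vector belongs to the invariant cone as soon as the parameter is large. -/
lemma exists_mem_cone {c : Fin 7 → ℝ} (hc : ∀ i, 0 < c i) :
    ∃ t : ℝ, 10 ≤ t ∧ c ∈ polyCone' (coneForms t) := by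
  obtain ⟨j, hj⟩ := Finite.exists_min c
  have hS : 0 < ∑ i, c i := Finset.sum_pos (fun i _ => hc i) Finset.univ_nonempty
  -- With `c j` the smallest entry, `t * c i` is at least ten times the sum of all entries, which
  -- outweighs the negative terms of every form.
  set t := 10 * (∑ i, c i) / c j with ht
  have hT : ∀ i, 10 * ∑ i, c i ≤ t * c i := fun i => by
    calc 10 * ∑ i, c i = t * c j := by rw [ht]; field_simp [(hc j).ne']
      _ ≤ t * c i := by
        have : 0 < t := by have := hc j; positivity
        gcongr
        exact hj i
  refine ⟨t, ?_, ⟨fun i => (hc i).le, ?_⟩, fun h => (hc 0).ne' (congrFun h 0)⟩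
  · rw [ht, le_div_iff₀ (hc j)]
    have := Finset.single_le_sum (f := c) (fun i _ => (hc i).le) (Finset.mem_univ j)
    linarith
  · have T0 := hT 0; have T1 := hT 1; have T2 := hT 2; have T3 := hT 3; have T4 := hT 4
    have T5 := hT 5; have T6 := hT 6
    have h0 := hc 0; have h1 := hc 1; have h2 := hc 2; have h3 := hc 3; have h4 := hc 4
    have h5 := hc 5; have h6 := hc 6
    have hsum : ∑ i, c i = c 0 + c 1 + c 2 + c 3 + c 4 + c 5 + c 6 := by
      rw [Fin.sum_univ_seven]
    rw [hsum] at T0 T1 T2 T3 T4 T5 T6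
    rw [coneForms_mulVec]
    clear_value t
    clear ht hT hsum hS hj
    intro i
    fin_cases i <;> simp <;> linarith

lemma ones_mem_cone {t : ℝ} (ht : 10 ≤ t) : (fun _ => 1) ∈ polyCone' (coneForms t) := by
  refine ⟨⟨fun _ => zero_le_one, ?_⟩, fun h => one_ne_zero (congrFun h 0)⟩
  rw [coneForms_mulVec]
  intro i
  fin_cases i <;> simp <;> linarith

/-- The matrices of the words that are contracting on the invariant cones. -/
def contractingBlocks (e : ℝ) : Set (Matrix (Fin 7) (Fin 7) ℝ) :=
  {M₂ e * M₀, M₂ e * M₁, M₁ * M₁ * M₁, M₁ * M₀ * M₁, M₀ * M₀ * M₀ * M₁, M₁ * M₀ * M₀ * M₁}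

set_option maxHeartbeats 2000000 in
-- The cone is small enough for each of the six blocks to make all forms strictly positive and every
-- coordinate either strictly positive or identically zero, by the inequalities of `cone_pos`.
lemma isContracting_of_mem_contractingBlocks {e t : ℝ} (he : e = 0 ∨ e = 1) (ht : 10 ≤ t)
    {Q : Matrix (Fin 7) (Fin 7) ℝ} (hQ : Q ∈ contractingBlocks e)
    (hQ0 : ∀ x ∈ polyCone' (coneForms t), Q.mulVec x ∈ polyCone' (coneForms t)) :
    IsContracting (coneForms t) Q := by
  refine isContracting_of_pos (ones_mem_cone ht) hQ0 (fun i => ?_) fun k => Or.inl fun x hx => ?_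
  · rw [or_iff_not_imp_right]
    intro hi x hx
    obtain ⟨⟨⟨p0, p1, p2, p3, p4, p5, p6⟩, -⟩, -⟩ := cone_facts ht hx.1
    obtain ⟨r0, r1, r2, r3, r4⟩ := cone_pos ht hx
    rcases hQ with rfl | rfl | rfl | rfl | rfl | rfl <;>
    rcases he with rfl | rfl <;> fin_cases i <;>
    simp [← Matrix.mulVec_mulVec, M₀_mulVec, M₁_mulVec, M₂_mulVec] at hi ⊢ <;> linarith
  · obtain ⟨⟨⟨p0, p1, p2, p3, p4, p5, p6⟩, q0, q1, q2, q3, q4, q5, q6⟩, f0, f1, f2, f3, f4, f5, f6,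
      f7, f8, f9, f10, f11, f12, f13, f14, f15, f16⟩ := cone_facts ht hx.1
    obtain ⟨r0, r1, r2, r3, r4⟩ := cone_pos ht hx
    rcases hQ with rfl | rfl | rfl | rfl | rfl | rfl
    iterate 2
      · simp only [← Matrix.mulVec_mulVec, M₀_mulVec, M₁_mulVec, M₂_mulVec, coneForms_mulVec,
          Matrix.cons_val]
        rcases he with rfl | rfl <;> fin_cases k <;> simp <;> linarith
    all_goals
      simp only [← Matrix.mulVec_mulVec, M₀_mulVec, M₁_mulVec, coneForms_mulVec, Matrix.cons_val]
      fin_cases k <;> simp <;> linarith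


/-! ### Convergence of the normalized products -/

lemma exists_l1norm_mulVec_le {d : ℕ} (Q : Matrix (Fin d) (Fin d) ℝ) :
    ∃ R : ℝ, 0 ≤ R ∧ ∀ x, l1norm (Q.mulVec x) ≤ R * l1norm x := by
  refine ⟨∑ i, ∑ j, |Q i j|, by positivity, fun x => ?_⟩
  rw [Finset.sum_mul]
  refine Finset.sum_le_sum fun i _ => ?_
  simp only [Matrix.mulVec, dotProduct]
  refine (Finset.abs_sum_le_sum_abs _ _).trans ?_
  rw [Finset.sum_mul]
  refine Finset.sum_le_sum fun j _ => ?_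
  rw [abs_mul]
  exact mul_le_mul_of_nonneg_left (abs_le_l1norm x j) (abs_nonneg _)

/-- If `A ^ N y` is close to a multiple of `u` that grows linearly, uniformly in `y ∈ Y`, then the
normalized vectors `P A ^ N y` converge to the normalized `P u`, uniformly in `y ∈ Y`. -/
lemma normalized_mulVec_pow_tendsto {d : ℕ} (P A : Matrix (Fin d) (Fin d) ℝ) {u : Fin d → ℝ}
    (hu : P.mulVec u ≠ 0) {Y : Set (Fin d → ℝ)} (k : Fin d) {κ C D : ℝ} (hκ : 0 < κ)
    (hC : 0 ≤ C) (hpos : ∀ y ∈ Y, 0 < y k) (hY : ∀ y ∈ Y, l1norm y ≤ D * y k)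
    (hA : ∀ y ∈ Y, ∀ (N : ℕ) i, |(A ^ N).mulVec y i - N * (κ * y k) * u i| ≤ C * l1norm y)
    {ε : ℝ} (hε : 0 < ε) :
    ∃ N₀ : ℕ, ∀ N ≥ N₀, ∀ y ∈ Y,
      dist (normalized (P.mulVec ((A ^ N).mulVec y))) (normalized (P.mulVec u)) < ε := by
  have hcont : ContinuousAt (fun v => normalized (P.mulVec v)) u :=
    ContinuousAt.comp (f := fun v => P.mulVec v) (continuousAt_normalized hu)
      (by fun_prop : Continuous fun v => P.mulVec v).continuousAt
  obtain ⟨δ, hδ, H⟩ := Metric.continuousAt_iff.1 hcont ε hε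
  obtain ⟨N₀, hN₀⟩ := exists_nat_gt (C * D / (κ * δ))
  refine ⟨N₀ + 1, fun N hN y hy => ?_⟩
  have hyk := hpos y hy
  have hN' : (N₀ : ℝ) < N := by exact_mod_cast hN
  have hNpos : (0 : ℝ) < N := (Nat.cast_nonneg N₀).trans_lt hN'
  -- Normalization ignores positive factors, and this one brings `A ^ N y` within `C D / (κ N)` of
  -- `u`, where the normalized map is continuous.
  set a : ℝ := (N * (κ * y k))⁻¹ with ha
  have ha0 : 0 < a := by positivity
  rw [← normalized_smul ha0, ← Matrix.mulVec_smul]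
  refine H ?_
  rw [dist_pi_lt_iff hδ]
  intro i
  rw [Real.dist_eq]
  have e1 : (a • (A ^ N).mulVec y) i - u i =
      a * ((A ^ N).mulVec y i - N * (κ * y k) * u i) := by
    simp only [Pi.smul_apply, smul_eq_mul, ha]
    field_simp
  rw [e1, abs_mul, abs_of_pos ha0]
  calc a * |(A ^ N).mulVec y i - N * (κ * y k) * u i| ≤ a * (C * (D * y k)) := by
        gcongr
        exact (hA y hy N i).trans (by gcongr; exact hY y hy)
    _ = C * D / κ / N := by rw [ha]; field_simp
    _ < δ := by
        rw [div_lt_iff₀ hNpos, div_lt_iff₀ hκ]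
        rw [div_lt_iff₀ (by positivity)] at hN₀
        calc C * D < N₀ * (κ * δ) := hN₀
          _ ≤ N * (κ * δ) := by gcongr
          _ = δ * N * κ := by ring

/-! ### Linear growth of the powers of `M₀` and `M₂` -/

lemma l1norm_seven {y : Fin 7 → ℝ} (hy : 0 ≤ y) :
    l1norm y = y 0 + y 1 + y 2 + y 3 + y 4 + y 5 + y 6 := by
  rw [l1norm_of_nonneg hy, Fin.sum_univ_seven]

/-- `M₀` fixes coordinate 0 and moves the others along the cycle 4 → 2 → 1 → 6 → 4, into which
coordinate 0 feeds once per step. A full turn takes four steps, whence the growth rate `y 0 / 4`. -/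
lemma M₀_pow_mulVec {y : Fin 7 → ℝ} (hy : 0 ≤ y) (N : ℕ) :
    (M₀ ^ N).mulVec y 0 = y 0 ∧ ∀ i, |(M₀ ^ N).mulVec y i -
      N * (1 / 4 * y 0) * (![0, 1, 1, 0, 1, 1, 1] : Fin 7 → ℝ) i| ≤ 4 * l1norm y := by
  have p : ∀ i, 0 ≤ y i := hy
  have p0 := p 0; have p1 := p 1; have p2 := p 2; have p3 := p 3; have p4 := p 4
  have p5 := p 5; have p6 := p 6
  have hs := l1norm_seven hy
  set s := l1norm y
  -- The offsets `y 0 / 4`, `y 0 / 2`, `- y 0 / 4` are chosen so that one more step merely permutes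
  -- the four errors; therefore they do not accumulate.
  have key : ∀ N : ℕ, ∃ z, (M₀ ^ N).mulVec y = z ∧ z 0 = y 0 ∧ |z 2 - N * y 0 / 4| ≤ 2 * s ∧
      |z 1 + y 0 / 4 - N * y 0 / 4| ≤ 2 * s ∧ |z 6 + y 0 / 2 - N * y 0 / 4| ≤ 2 * s ∧
      |z 3 + z 4 - y 0 / 4 - N * y 0 / 4| ≤ 2 * s ∧ 0 ≤ z 3 ∧ z 3 ≤ s ∧
      |z 5 - N * y 0 / 4| ≤ 4 * s := by
    intro N
    induction N with
    | zero =>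
      refine ⟨y, by simp, rfl, ?_⟩
      simp only [abs_le]
      push_cast
      refine ⟨⟨?_, ?_⟩, ⟨?_, ?_⟩, ⟨?_, ?_⟩, ⟨?_, ?_⟩, ?_, ?_, ?_, ?_⟩ <;> linarith
    | succ N ih =>
      obtain ⟨z, hz, h0, h2, h1, h6, h34, h3, h3', h5⟩ := ih
      refine ⟨M₀.mulVec z, by rw [pow_succ', ← Matrix.mulVec_mulVec, hz], ?_⟩
      rw [M₀_mulVec]
      simp only [abs_le, Matrix.cons_val] at *
      push_cast
      refine ⟨h0, ⟨?_, ?_⟩, ⟨?_, ?_⟩, ⟨?_, ?_⟩, ⟨?_, ?_⟩, ?_, ?_, ?_, ?_⟩ <;> linarith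
  obtain ⟨z, hz, h0, h2, h1, h6, h34, h3, h3', h5⟩ := key N
  rw [hz]
  refine ⟨h0, fun i => ?_⟩
  simp only [abs_le] at *
  fin_cases i <;> simp <;> constructor <;> linarith

/-- Coordinate 4 is fixed and is added at each step to `z 3` and to `z 0 + z 6`; coordinate 2
follows the latter sum with a delay of one step. -/
lemma M₂_pow_mulVec {e : ℝ} (he : 0 ≤ e) (he1 : e ≤ 1) {y : Fin 7 → ℝ} (hy : 0 ≤ y) (N : ℕ) :
    (M₂ e ^ N).mulVec y 4 = y 4 ∧ ∀ i, |(M₂ e ^ N).mulVec y i -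
      N * (1 * y 4) * (![1, 0, 1, 1, 0, 0, 0] : Fin 7 → ℝ) i| ≤ 4 * l1norm y := by
  have p : ∀ i, 0 ≤ y i := hy
  have p0 := p 0; have p1 := p 1; have p2 := p 2; have p3 := p 3; have p4 := p 4
  have p5 := p 5; have p6 := p 6
  have hs := l1norm_seven hy
  have e1 : 0 ≤ e * y 4 := by positivity
  have e2 : e * y 4 ≤ y 4 := mul_le_of_le_one_left p4 he1
  set s := l1norm y
  have key : ∀ N : ℕ, ∃ z, (M₂ e ^ N).mulVec y = z ∧ z 4 = y 4 ∧
      z 0 + z 6 = y 0 + y 6 + N * y 4 ∧ z 3 = y 3 + N * y 4 ∧ |z 2 - N * y 4| ≤ s ∧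
      0 ≤ z 1 ∧ z 1 ≤ s ∧ 0 ≤ z 5 ∧ z 5 ≤ s ∧ 0 ≤ z 6 ∧ z 6 ≤ s := by
    intro N
    induction N with
    | zero =>
      refine ⟨y, by simp, rfl, ?_⟩
      simp only [abs_le]
      push_cast
      refine ⟨?_, ?_, ⟨?_, ?_⟩, ?_, ?_, ?_, ?_, ?_, ?_⟩ <;> linarith
    | succ N ih =>
      obtain ⟨z, hz, h4, h0, h3, h2, h1, h1', h5, h5', h6, h6'⟩ := ih
      refine ⟨(M₂ e).mulVec z, by rw [pow_succ', ← Matrix.mulVec_mulVec, hz], ?_⟩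
      rw [M₂_mulVec]
      simp only [abs_le, Matrix.cons_val] at *
      rw [h4]
      push_cast
      refine ⟨rfl, ?_, ?_, ⟨?_, ?_⟩, ?_, ?_, ?_, ?_, ?_, ?_⟩ <;> linarith
  obtain ⟨z, hz, h4, h0, h3, h2, h1, h1', h5, h5', h6, h6'⟩ := key N
  rw [hz]
  refine ⟨h4, fun i => ?_⟩
  simp only [abs_le] at *
  fin_cases i <;> simp <;> constructor <;> linarith

/-- The positive vector `c` and the vectors of `M_b K'` for the letters `b ≠ a`. -/
def nonTail (e t : ℝ) (c : Fin 7 → ℝ) (a : Fin 3) : Set (Fin 7 → ℝ) :=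
  {y | y ∈ polyCone' (coneForms t) ∧
    (y = c ∨ ∃ b ≠ a, ∃ z ∈ polyCone' (coneForms t), y = (matrices e b).mulVec z)}

lemma orbit_mem_cone {e t : ℝ} {c : Fin 7 → ℝ} (he : e = 0 ∨ e = 1) (ht : 10 ≤ t)
    (hc : c ∈ polyCone' (coneForms t)) (ω : ℕ → Fin 3) (n : ℕ) :
    (prefixProd (matrices e) ω n).mulVec c ∈ polyCone' (coneForms t) :=
  prefixProd_invariant _ (fun a _ hx => matrices_mulVec_mem_cone' he ht a hx) _ _ _ hc

/-- Collect the leading letters `a`; the rest is either empty, leaving `c`, or begins with another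
letter. -/
lemma exists_nonTail {e t : ℝ} {c : Fin 7 → ℝ} (he : e = 0 ∨ e = 1) (ht : 10 ≤ t)
    (hc : c ∈ polyCone' (coneForms t)) (a : Fin 3) (m : ℕ) (η : ℕ → Fin 3) :
    ∃ j ≤ m, ∃ y ∈ nonTail e t c a, (prefixProd (matrices e) η m).mulVec c =
      ((matrices e a) ^ j).mulVec y := by
  induction m generalizing η with
  | zero => exact ⟨0, le_rfl, c, ⟨hc, Or.inl rfl⟩, by simp [prefixProd]⟩
  | succ m ih =>
    rw [prefixProd_succ', ← Matrix.mulVec_mulVec]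
    by_cases h : η 0 = a
    · obtain ⟨j, hj, y, hy, e1⟩ := ih (shift 1 η)
      exact ⟨j + 1, by omega, y, hy, by rw [e1, h, Matrix.mulVec_mulVec, ← pow_succ']⟩
    · have h1 := orbit_mem_cone he ht hc (shift 1 η) m
      exact ⟨0, Nat.zero_le _, _, ⟨matrices_mulVec_mem_cone' he ht _ h1,
        Or.inr ⟨η 0, h, _, h1, rfl⟩⟩, by simp⟩

/-- The coordinate `k` may vanish on the cone, but not on its images under the letters other than
`a`; compactness gives a bound for each of these letters, and `c` needs only its own ratio. -/
lemma exists_l1norm_le_nonTail {e t : ℝ} {c : Fin 7 → ℝ} {a : Fin 3} {k : Fin 7} (hck : 0 < c k)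
    (hk : ∀ b ≠ a, ∀ x ∈ polyCone' (coneForms t), 0 < (matrices e b).mulVec x k) :
    ∃ D : ℝ, 0 < D ∧ ∀ y ∈ nonTail e t c a, l1norm y ≤ D * y k := by
  have h1 : ∀ b : Fin 3, ∃ D : ℝ, 0 < D ∧ (b ≠ a → ∀ x ∈ polyCone (coneForms t),
      l1norm ((matrices e b).mulVec x) ≤ D * (matrices e b).mulVec x k) := by
    intro b
    by_cases hb : b = a
    · exact ⟨1, one_pos, fun h => (h hb).elim⟩
    obtain ⟨m, hm, H⟩ := exists_mul_l1norm_le (B := coneForms t)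
      (φ := fun x => (matrices e b).mulVec x k) (by fun_prop)
      (fun a x => by rw [Matrix.mulVec_smul]; rfl) (hk b hb)
    obtain ⟨R, hR, H2⟩ := exists_l1norm_mulVec_le (matrices e b)
    refine ⟨R / m + 1, by positivity, fun _ x hx => ?_⟩
    have h3 := H x hx
    have hx0 := l1norm_nonneg x
    have h4 : 0 ≤ (matrices e b).mulVec x k := le_trans (by positivity) h3
    calc l1norm ((matrices e b).mulVec x) ≤ R * l1norm x := H2 x
      _ = R / m * (m * l1norm x) := by field_simp
      _ ≤ R / m * (matrices e b).mulVec x k := by gcongr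
      _ ≤ (R / m + 1) * (matrices e b).mulVec x k := by gcongr; linarith
  choose D hD H using h1
  have hDs : ∀ b, D b ≤ ∑ b, D b := fun b =>
    Finset.single_le_sum (fun b _ => (hD b).le) (Finset.mem_univ b)
  have hc0 := l1norm_nonneg c
  have hS : 0 < ∑ b, D b := (hD 0).trans_le (hDs 0)
  refine ⟨∑ b, D b + l1norm c / c k, by positivity, ?_⟩
  rintro y ⟨hyK, rfl | ⟨b, hb, z, hz, rfl⟩⟩
  · have : l1norm y / y k * y k = l1norm y := by field_simp
    nlinarith
  · have h5 := H b hb z hz.1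
    have h6 := hk b hb z hz
    refine h5.trans ?_
    have : 0 ≤ l1norm c / c k := by positivity
    gcongr
    linarith [hDs b]

/-- Uniform convergence along the sequences that coincide with a sequence ending with a power of
one letter. -/
lemma local_cauchy_of_eventually_eq {e t : ℝ} {c : Fin 7 → ℝ} (he : e = 0 ∨ e = 1) (ht : 10 ≤ t)
    (hc : c ∈ polyCone' (coneForms t))
    {a : Fin 3} {k : Fin 7} {u : Fin 7 → ℝ} {κ : ℝ} (hκ : 0 < κ)
    (hck : 0 < c k)
    (hk : ∀ b ≠ a, ∀ x ∈ polyCone' (coneForms t), 0 < (matrices e b).mulVec x k)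
    (hu : u ∈ polyCone' (coneForms t))
    (hA : ∀ y : Fin 7 → ℝ, 0 ≤ y → ∀ (N : ℕ) i,
      |((matrices e a) ^ N).mulVec y i - N * (κ * y k) * u i| ≤ 4 * l1norm y)
    {ω : ℕ → Fin 3} {m : ℕ} (hω : ∀ n ≥ m, ω n = a) {ε : ℝ} (hε : 0 < ε) :
    ∃ n, ∀ (η η' : ℕ → Fin 3) (p p' : ℕ),
      dist (normalized ((prefixProd (matrices e) ω n).mulVec
          ((prefixProd (matrices e) η p).mulVec c)))
        (normalized ((prefixProd (matrices e) ω n).mulVec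
          ((prefixProd (matrices e) η' p').mulVec c))) ≤ ε := by
  obtain ⟨D, hD, HD⟩ := exists_l1norm_le_nonTail hck hk
  set P := prefixProd (matrices e) ω m with hP
  have hPu : P.mulVec u ≠ 0 := (prefixProd_invariant _
    (fun a _ hx => matrices_mulVec_mem_cone' he ht a hx) ω m u hu).2
  -- After the prefix `P` and at least `N` letters `a`, every continuation is close to the direction
  -- of `P u`. Further letters `a` at the beginning of the continuation only increase the exponent.
  obtain ⟨N, hN⟩ := normalized_mulVec_pow_tendsto P (matrices e a) hPu
    (Y := nonTail e t c a) k hκ (by norm_num : (0 : ℝ) ≤ 4)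
    (fun y hy => by
      by_contra! h
      have h1 := l1norm_pos hy.1.2
      have h2 := HD y hy
      nlinarith) HD (fun y hy => hA y hy.1.1.1) (half_pos hε)
  have e1 : prefixProd (matrices e) ω (m + N) = P * (matrices e a) ^ N := by
    rw [prefixProd_add, prefixProd_const (ω := shift m ω) (n := N) (a := a)]
    exact fun i _ => hω _ (Nat.le_add_left m i)
  have e2 : ∀ (η : ℕ → Fin 3) (p : ℕ),
      dist (normalized ((prefixProd (matrices e) ω (m + N)).mulVec
        ((prefixProd (matrices e) η p).mulVec c))) (normalized (P.mulVec u)) < ε / 2 := by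
    intro η p
    obtain ⟨j, -, y, hy, h⟩ := exists_nonTail he ht hc a p η
    rw [h, e1, ← Matrix.mulVec_mulVec, Matrix.mulVec_mulVec _ (matrices e a ^ N), ← pow_add]
    exact hN _ (by omega) y hy
  refine ⟨m + N, fun η η' p p' => (dist_triangle_right _ _ (normalized (P.mulVec u))).trans ?_⟩
  linarith [e2 η p, e2 η' p']

/-- A sequence that does not end with `000…` or `222…` contains infinitely many contracting
blocks. -/
lemma exists_contractingBlock (e : ℝ) {ω : ℕ → Fin 3} (h0 : ∀ m, ∃ n ≥ m, ω n ≠ 0)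
    (h2 : ∀ m, ∃ n ≥ m, ω n ≠ 2) (N : ℕ) :
    ∃ n ≥ N, ∃ L, prefixProd (matrices e) (shift n ω) L ∈ contractingBlocks e := by
  have two : ∀ n, prefixProd (matrices e) (shift n ω) 2 =
      matrices e (ω n) * matrices e (ω (n + 1)) := fun n => by
    simp [prefixProd, shift, add_comm]
  have three : ∀ n, prefixProd (matrices e) (shift n ω) 3 =
      matrices e (ω n) * matrices e (ω (n + 1)) * matrices e (ω (n + 2)) := fun n => by
    simp [prefixProd, shift, add_comm]
  have four : ∀ n, prefixProd (matrices e) (shift n ω) 4 = matrices e (ω n) *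
      matrices e (ω (n + 1)) * matrices e (ω (n + 2)) * matrices e (ω (n + 3)) := fun n => by
    simp [prefixProd, shift, add_comm]
  by_cases hinf : ∃ n ≥ N, ω n = 2
  · obtain ⟨n, hn, hn2⟩ := hinf
    have hex : ∃ k, ω (n + k) ≠ 2 := by
      obtain ⟨m, hm, hm2⟩ := h2 n
      exact ⟨m - n, by rwa [Nat.add_sub_cancel' hm]⟩
    classical
    obtain ⟨k, hk, hmin⟩ : ∃ k, ω (n + k) ≠ 2 ∧ ∀ j < k, ω (n + j) = 2 :=
      ⟨Nat.find hex, Nat.find_spec hex, fun j hj => not_not.1 (Nat.find_min hex hj)⟩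
    obtain ⟨k, rfl⟩ : ∃ k', k = k' + 1 :=
      Nat.exists_eq_succ_of_ne_zero (by rintro rfl; exact hk hn2)
    have h3 := hmin k k.lt_succ_self
    refine ⟨n + k, by omega, 2, ?_⟩
    rw [two, h3, show n + k + 1 = n + (k + 1) by ring]
    have : ω (n + (k + 1)) = 0 ∨ ω (n + (k + 1)) = 1 := by
      generalize ω (n + (k + 1)) = a at hk
      fin_cases a <;> simp_all
    rcases this with h | h <;> rw [h] <;> simp [matrices, contractingBlocks]
  · push Not at hinf
    have h01 : ∀ n ≥ N, ω n = 0 ∨ ω n = 1 := by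
      intro n hn
      have := hinf n hn
      generalize ω n = a at this
      fin_cases a <;> simp_all
    have block : ∀ n ≥ N, ω (n + 2) = 0 → ω (n + 3) = 1 →
        ∃ n ≥ N, ∃ L, prefixProd (matrices e) (shift n ω) L ∈ contractingBlocks e := by
      intro n hn h4 h5
      rcases h01 (n + 1) (by omega) with h | h
      · refine ⟨n, hn, 4, ?_⟩
        rw [four, h, h4, h5]
        rcases h01 n hn with h' | h' <;> rw [h'] <;> simp [matrices, contractingBlocks]
      · refine ⟨n + 1, by omega, 3, ?_⟩
        rw [three, h, h4, h5]
        simp [matrices, contractingBlocks]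
    -- A letter 1 with four letters before it: looking backwards, one meets 111, 101, 0001 or 1001,
    -- ending at this 1 or at the preceding one, and starting no earlier than `N`.
    obtain ⟨n, hn, hn0⟩ := h0 (N + 4)
    obtain ⟨n, rfl⟩ := Nat.exists_eq_add_of_le' hn
    rw [← add_assoc] at hn0
    have h5 : ω (n + N + 4) = 1 := (h01 _ (by omega)).resolve_left hn0
    rcases h01 (n + N + 3) (by omega) with h | h
    · exact block (n + N + 1) (by omega) h h5
    · rcases h01 (n + N + 2) (by omega) with h' | h'
      · exact block (n + N) (by omega) h' h
      · refine ⟨n + N + 2, by omega, 3, ?_⟩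
        rw [three, h', h, h5]
        simp [matrices, contractingBlocks]

lemma dist_le_of_oscLE {d : ℕ} {ι : Type*} {B : Matrix ι (Fin d) ℝ}
    {P : Matrix (Fin d) (Fin d) ℝ} {δ : ℝ} (hδ : 0 ≤ δ) (h : OscLE B P δ) {x y : Fin d → ℝ}
    (hx : x ∈ polyCone' B) (hy : y ∈ polyCone' B) :
    dist (normalized (P.mulVec x)) (normalized (P.mulVec y)) ≤ δ := by
  rw [dist_pi_le_iff hδ]
  intro i
  rw [Real.dist_eq, abs_le]
  constructor <;> linarith [h x hx y hy i, h y hy x hx i]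

theorem exists_tendstoUniformly_normalized {e : ℝ} (he : e = 0 ∨ e = 1) {c : Fin 7 → ℝ}
    (hc : ∀ i, 0 < c i) :
    ∃ l : (ℕ → Fin 3) → Fin 7 → ℝ,
      TendstoUniformly
        (fun (n : ℕ) (ω : ℕ → Fin 3) => normalized ((prefixProd (matrices e) ω n).mulVec c))
        l atTop := by
  obtain ⟨t, ht, hcK⟩ := exists_mem_cone hc
  have he0 : 0 ≤ e := by rcases he with rfl | rfl <;> norm_num
  have he1 : e ≤ 1 := by rcases he with rfl | rfl <;> norm_num
  have hinv : ∀ a, ∀ x ∈ polyCone' (coneForms t), (matrices e a).mulVec x ∈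
    polyCone' (coneForms t) := fun a x hx => matrices_mulVec_mem_cone' he ht a hx
  -- A long enough prefix of `ω` determines the direction up to `ε`, whatever word follows it and
  -- whatever its length.
  have main : ∀ ω : ℕ → Fin 3, ∀ ε > 0, ∃ n, ∀ (η η' : ℕ → Fin 3) (p p' : ℕ),
      dist (normalized ((prefixProd (matrices e) ω n).mulVec
          ((prefixProd (matrices e) η p).mulVec c)))
        (normalized ((prefixProd (matrices e) ω n).mulVec
          ((prefixProd (matrices e) η' p').mulVec c))) ≤ ε := by
    intro ω ε hε
    by_cases h0 : ∃ m, ∀ n ≥ m, ω n = 0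
    · obtain ⟨m, hm⟩ := h0
      refine local_cauchy_of_eventually_eq he ht hcK (a := 0) (k := 0)
        (u := ![0, 1, 1, 0, 1, 1, 1]) (κ := 1 / 4) (by norm_num) (hc 0) ?_ ?_
        (fun y hy N => (M₀_pow_mulVec hy N).2) hm hε
      · intro b hb x hx
        obtain ⟨⟨⟨p0, p1, p2, p3, p4, p5, p6⟩, -⟩, -⟩ := cone_facts ht hx.1
        obtain ⟨r0, r1, r2, r3, r4⟩ := cone_pos ht hx
        fin_cases b
        · simp at hb
        · simp [matrices, M₁_mulVec]; linarith
        · simp [matrices, M₂_mulVec]; linarith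
      · refine ⟨⟨fun i => by fin_cases i <;> simp, ?_⟩, fun h => ?_⟩
        · rw [coneForms_mulVec]
          intro i
          fin_cases i <;> simp <;> linarith
        · simpa using congrFun h 1
    by_cases h2 : ∃ m, ∀ n ≥ m, ω n = 2
    · obtain ⟨m, hm⟩ := h2
      refine local_cauchy_of_eventually_eq he ht hcK (a := 2) (k := 4)
        (u := ![1, 0, 1, 1, 0, 0, 0]) (κ := 1) one_pos (hc 4) ?_ ?_
        (fun y hy N => (M₂_pow_mulVec he0 he1 hy N).2) hm hε
      · intro b hb x hx
        obtain ⟨⟨⟨p0, p1, p2, p3, p4, p5, p6⟩, -⟩, -⟩ := cone_facts ht hx.1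
        obtain ⟨r0, r1, r2, r3, r4⟩ := cone_pos ht hx
        fin_cases b
        · simp [matrices, M₀_mulVec]; linarith
        · simp [matrices, M₁_mulVec]; linarith
        · simp at hb
      · refine ⟨⟨fun i => by fin_cases i <;> simp, ?_⟩, fun h => ?_⟩
        · rw [coneForms_mulVec]
          intro i
          fin_cases i <;> simp <;> linarith
        · simpa using congrFun h 0
    push Not at h0 h2
    have hQinv : ∀ Q ∈ contractingBlocks e, ∀ x ∈ polyCone' (coneForms t),
        Q.mulVec x ∈ polyCone' (coneForms t) := by
      intro Q hQ x hx
      have i0 : ∀ x ∈ polyCone' (coneForms t), M₀.mulVec x ∈ polyCone' (coneForms t) := hinv 0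
      have i1 : ∀ x ∈ polyCone' (coneForms t), M₁.mulVec x ∈ polyCone' (coneForms t) := hinv 1
      have i2 : ∀ x ∈ polyCone' (coneForms t), (M₂ e).mulVec x ∈ polyCone' (coneForms t) :=
        hinv 2
      rcases hQ with rfl | rfl | rfl | rfl | rfl | rfl <;> simp only [← Matrix.mulVec_mulVec]
      exacts [i2 _ (i0 _ hx), i2 _ (i1 _ hx), i1 _ (i1 _ (i1 _ hx)), i1 _ (i0 _ (i1 _ hx)),
        i0 _ (i0 _ (i0 _ (i1 _ hx))), i1 _ (i0 _ (i0 _ (i1 _ hx)))]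
    obtain ⟨n, hn⟩ := exists_oscLE_prefixProd (matrices_nonneg he0) hinv (contractingBlocks e)
      (by simp [contractingBlocks]) ⟨_, Or.inl rfl⟩
      (fun Q hQ => ⟨isContracting_of_mem_contractingBlocks he ht hQ (hQinv Q hQ), hQinv Q hQ⟩)
      (exists_contractingBlock e h0 h2) hε
    exact ⟨n, fun η η' p p' => dist_le_of_oscLE hε.le hn (orbit_mem_cone he ht hcK η p)
      (orbit_mem_cone he ht hcK η' p')⟩
  refine exists_tendstoUniformly_of_local _ fun ω ε hε => ?_
  obtain ⟨n, hn⟩ := main ω ε hε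
  refine ⟨n, fun η hη m hm m' hm' => ?_⟩
  obtain ⟨p, rfl⟩ := Nat.exists_eq_add_of_le hm
  obtain ⟨p', rfl⟩ := Nat.exists_eq_add_of_le hm'
  rw [prefixProd_add, prefixProd_add, ← Matrix.mulVec_mulVec, ← Matrix.mulVec_mulVec,
    prefixProd_congr (η := ω) _ fun i hi => hη i hi]
  exact hn _ _ _ _


/-! ### The weak Gibbs property of the sequences of matrix products -/

lemma continuous_prefixProd {b d : ℕ} (M : Fin b → Matrix (Fin d) (Fin d) ℝ) (n : ℕ) :
    Continuous fun ω : ℕ → Fin b => prefixProd M ω n := by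
  induction n with
  | zero => exact continuous_const
  | succ n ih =>
    exact ih.matrix_mul (continuous_of_discreteTopology.comp (continuous_apply n))

lemma continuous_shift {b : ℕ} (k : ℕ) : Continuous (shift k : (ℕ → Fin b) → ℕ → Fin b) :=
  continuous_pi fun n => continuous_apply (n + k)

lemma continuous_of_letter {b : ℕ} {h : Fin b → (ℕ → Fin b) → ℝ} (hh : ∀ a, Continuous (h a)) :
    Continuous fun ω => h (ω 0) ω := by
  have h2 : Continuous fun p : Fin b × (ℕ → Fin b) => h p.1 p.2 :=
    continuous_prod_of_discrete_left.2 hh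
  have h3 : Continuous fun ω : ℕ → Fin b => (ω 0, ω) := by fun_prop
  exact h2.comp h3

section

variable {e t : ℝ} {c : Fin 7 → ℝ}

/-- A leading run of the letter `a` leaves coordinate `k` unchanged while the norm grows at most
linearly in its length; before the run the two are comparable. -/
lemma exists_l1norm_le_mul_of_pow {a : Fin 3} {k : Fin 7} {u : Fin 7 → ℝ} {κ : ℝ} (hκ : 0 < κ)
    (he : e = 0 ∨ e = 1) (ht : 10 ≤ t) (hc : c ∈ polyCone' (coneForms t)) (hck : 0 < c k)
    (hk : ∀ b ≠ a, ∀ x ∈ polyCone' (coneForms t), 0 < (matrices e b).mulVec x k)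
    (hA : ∀ y : Fin 7 → ℝ, 0 ≤ y → ∀ N : ℕ, ((matrices e a) ^ N).mulVec y k = y k ∧ ∀ i,
      |((matrices e a) ^ N).mulVec y i - N * (κ * y k) * u i| ≤ 4 * l1norm y) :
    ∃ A : ℝ, 0 < A ∧ ∀ (η : ℕ → Fin 3) (n : ℕ),
      l1norm ((prefixProd (matrices e) η n).mulVec c) ≤
        A * (n + 1) * (prefixProd (matrices e) η n).mulVec c k := by
  obtain ⟨D, hD, HD⟩ := exists_l1norm_le_nonTail hck hk
  have hu := l1norm_nonneg u
  -- The 28 is the error bound 4 summed over seven coordinates.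
  refine ⟨κ * l1norm u + 28 * D, by positivity, fun η n => ?_⟩
  obtain ⟨j, hj, y, hy, h⟩ := exists_nonTail he ht hc a n η
  have hj' : (j : ℝ) ≤ n := by exact_mod_cast hj
  obtain ⟨h1, h2⟩ := hA y hy.1.1.1 j
  have hyk : 0 ≤ y k := hy.1.1.1 k
  rw [h, h1]
  have h3 : ∀ i, |(matrices e a ^ j).mulVec y i| ≤ j * (κ * y k) * |u i| + 4 * l1norm y := by
    intro i
    have h4 := h2 i
    have h5 : |(j : ℝ) * (κ * y k) * u i| = j * (κ * y k) * |u i| := by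
      rw [abs_mul, abs_of_nonneg (by positivity)]
    have h6 := abs_sub_abs_le_abs_sub ((matrices e a ^ j).mulVec y i) (j * (κ * y k) * u i)
    linarith
  calc l1norm ((matrices e a ^ j).mulVec y)
      ≤ ∑ i, (j * (κ * y k) * |u i| + 4 * l1norm y) := Finset.sum_le_sum fun i _ => h3 i
    _ = j * (κ * y k) * l1norm u + 28 * l1norm y := by
        rw [Finset.sum_add_distrib, ← Finset.mul_sum]
        simp [l1norm]; ring
    _ ≤ n * (κ * y k) * l1norm u + 28 * (D * y k) := by
        gcongr
        exact HD y hy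
    _ ≤ (κ * l1norm u + 28 * D) * (n + 1) * y k := by
        have : 0 ≤ κ * l1norm u * y k := by positivity
        have : 0 ≤ 28 * D * n * y k := by positivity
        nlinarith

lemma matrices_mulVec_zero_pos (ht : 10 ≤ t) {b : Fin 3} (hb : b ≠ 0) {x : Fin 7 → ℝ}
    (hx : x ∈ polyCone' (coneForms t)) : 0 < (matrices e b).mulVec x 0 := by
  obtain ⟨⟨⟨p0, p1, p2, p3, p4, p5, p6⟩, -⟩, -⟩ := cone_facts ht hx.1
  obtain ⟨r0, r1, r2, r3, r4⟩ := cone_pos ht hx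
  fin_cases b
  · simp at hb
  · simp [matrices, M₁_mulVec]; linarith
  · simp [matrices, M₂_mulVec]; linarith

lemma matrices_mulVec_four_pos (ht : 10 ≤ t) {b : Fin 3} (hb : b ≠ 2) {x : Fin 7 → ℝ}
    (hx : x ∈ polyCone' (coneForms t)) : 0 < (matrices e b).mulVec x 4 := by
  obtain ⟨r0, r1, r2, r3, r4⟩ := cone_pos ht hx
  fin_cases b
  · simp [matrices, M₀_mulVec]; linarith
  · simp [matrices, M₁_mulVec]; linarith
  · simp at hb

/-- The coordinates of index `0, 2, 4` of the products are not much smaller than the norm. -/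
lemma exists_l1norm_le_coord (he : e = 0 ∨ e = 1) (hc : ∀ i, 0 < c i) (a : Fin 3) :
    ∃ A : ℝ, 0 < A ∧ ∀ (η : ℕ → Fin 3) (n : ℕ),
      l1norm ((prefixProd (matrices e) η n).mulVec c) ≤
        A * (n + 1) * (prefixProd (matrices e) η n).mulVec c ((![0, 2, 4] : Fin 3 → Fin 7) a) := by
  obtain ⟨t, ht, hcK⟩ := exists_mem_cone hc
  have he0 : 0 ≤ e := by rcases he with rfl | rfl <;> norm_num
  have he1 : e ≤ 1 := by rcases he with rfl | rfl <;> norm_num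
  fin_cases a
  · exact exists_l1norm_le_mul_of_pow (a := 0) (k := 0) (κ := 1 / 4) (by norm_num) he ht hcK (hc 0)
      (fun b hb x hx => matrices_mulVec_zero_pos ht hb hx)
      fun y hy N => M₀_pow_mulVec hy N
  · obtain ⟨m, hm, H⟩ := exists_mul_l1norm_le (B := coneForms t) (φ := fun x => x 2)
      (by fun_prop) (fun a x => rfl) (fun x hx => (cone_pos ht hx).1)
    refine ⟨1 / m, by positivity, fun η n => ?_⟩
    have h := (orbit_mem_cone he ht hcK η n).1
    have h1 := H _ h
    have h2 : 0 ≤ (prefixProd (matrices e) η n).mulVec c 2 := h.1 2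
    change _ ≤ _ * (prefixProd (matrices e) η n).mulVec c 2
    calc _ = 1 / m * (m * l1norm ((prefixProd (matrices e) η n).mulVec c)) := by field_simp
      _ ≤ 1 / m * (prefixProd (matrices e) η n).mulVec c 2 := by gcongr
      _ ≤ 1 / m * (n + 1) * (prefixProd (matrices e) η n).mulVec c 2 := by
        gcongr
        exact le_mul_of_one_le_right (by positivity) (by linarith [Nat.cast_nonneg (α := ℝ) n])
  · exact exists_l1norm_le_mul_of_pow (a := 2) (k := 4) (κ := 1) (by norm_num) he ht hcK (hc 4)
      (fun b hb x hx => matrices_mulVec_four_pos ht hb hx)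
      fun y hy N => M₂_pow_mulVec he0 he1 hy N

set_option maxHeartbeats 800000 in
/-- The logarithms of the norms of the products are close to Birkhoff sums of a continuous
function. -/
lemma exists_birkhoff_approx (he : e = 0 ∨ e = 1) (hc : ∀ i, 0 < c i) :
    ∃ G : (ℕ → Fin 3) → ℝ, Continuous G ∧ (∃ C, ∀ ω, |G ω| ≤ C) ∧ ∀ ε > 0, ∃ A, ∀ n ω,
      |Real.log (l1norm ((prefixProd (matrices e) ω n).mulVec c)) -
        ∑ k ∈ Finset.range n, G (shift k ω)| ≤ A + ε * n := by
  obtain ⟨l, hl⟩ := exists_tendstoUniformly_normalized he hc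
  obtain ⟨t, ht, hcK⟩ := exists_mem_cone hc
  set F : ℕ → (ℕ → Fin 3) → Fin 7 → ℝ :=
    fun n ω => normalized ((prefixProd (matrices e) ω n).mulVec c) with hF
  have hne : ∀ n ω, (prefixProd (matrices e) ω n).mulVec c ≠ 0 := fun n ω =>
    (orbit_mem_cone he ht hcK ω n).2
  have hFcont : ∀ n, Continuous (F n) := fun n => continuous_iff_continuousAt.2 fun ω =>
    ContinuousAt.comp (f := fun ω => (prefixProd (matrices e) ω n).mulVec c)
      (continuousAt_normalized (hne n ω))
      ((continuous_prefixProd _ n).matrix_mulVec continuous_const).continuousAt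
  have hlcont : Continuous l := hl.continuous (Eventually.of_forall hFcont).frequently
  set S : Set (Fin 7 → ℝ) := polyCone (coneForms t) ∩ {x | l1norm x = 1} with hS
  have hSc : IsClosed S := isClosed_polyCone.inter (isClosed_eq continuous_l1norm continuous_const)
  have hFS : ∀ n ω, F n ω ∈ S := fun n ω =>
    ⟨normalized_mem_polyCone (orbit_mem_cone he ht hcK ω n).1, l1norm_normalized (hne n ω)⟩
  have hlS : ∀ ω, l ω ∈ S := fun ω =>
    hSc.mem_of_tendsto (hl.tendsto_at ω) (Eventually.of_forall fun n => hFS n ω)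
  have hScomp : IsCompact S := by
    refine Metric.isCompact_of_isClosed_isBounded hSc
      ((Metric.isBounded_closedBall (x := (0 : Fin 7 → ℝ)) (r := 1)).subset fun x hx => ?_)
    rw [mem_closedBall_zero_iff, pi_norm_le_iff_of_nonneg zero_le_one]
    exact fun i => (abs_le_l1norm x i).trans_eq hx.2
  have hSpos : ∀ a, ∀ x ∈ S, 0 < l1norm ((matrices e a).mulVec x) := fun a x hx =>
    l1norm_pos (matrices_mulVec_mem_cone' he ht a ⟨hx.1, by
      rintro rfl
      simpa using hx.2⟩).2
  set g : Fin 3 → (Fin 7 → ℝ) → ℝ := fun a x => Real.log (l1norm ((matrices e a).mulVec x)) with hg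
  have hgc : ∀ a, ContinuousOn (g a) S := fun a =>
    (continuous_l1norm.comp (by fun_prop : Continuous fun x : Fin 7 → ℝ =>
      (matrices e a).mulVec x)).continuousOn.log fun x hx => (hSpos a x hx).ne'
  have hgb : ∃ C, ∀ a, ∀ x ∈ S, |g a x| ≤ C := by
    choose C hC using fun a => hScomp.exists_bound_of_continuousOn (hgc a)
    obtain ⟨a0, ha0⟩ := Finite.exists_max C
    exact ⟨C a0, fun a x hx => (hC a x hx).trans (ha0 a)⟩
  obtain ⟨C, hC⟩ := hgb
  have hunif : ∀ ε > 0, ∃ N, ∀ n ≥ N, ∀ a ω, |g a (F n ω) - g a (l ω)| ≤ ε := by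
    intro ε hε
    have h1 : ∀ a, ∃ N, ∀ n ≥ N, ∀ ω, |g a (F n ω) - g a (l ω)| ≤ ε := by
      intro a
      have h2 := UniformContinuousOn.comp_tendstoUniformly hFS hlS
        (hScomp.uniformContinuousOn_of_continuous (hgc a)) hl
      obtain ⟨N, hN⟩ := eventually_atTop.1 (Metric.tendstoUniformly_iff.1 h2 ε hε)
      refine ⟨N, fun n hn ω => ?_⟩
      have := (hN n hn ω).le
      rwa [dist_comm, Real.dist_eq] at this
    choose N hN using h1
    exact ⟨∑ a, N a, fun n hn a ω => hN a n
      ((Finset.single_le_sum (fun _ _ => Nat.zero_le _) (Finset.mem_univ a)).trans hn) ω⟩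
  -- The first matrix is the last to act, so removing the first letter compares the product with the
  -- one along the shifted sequence, whose direction is close to `l (shift 1 ω)`.
  set G : (ℕ → Fin 3) → ℝ := fun ω => g (ω 0) (l (shift 1 ω)) with hG
  refine ⟨G, ?_, ⟨C, fun ω => hC _ _ (hlS _)⟩, fun ε hε => ?_⟩
  · have h1 : ∀ a, Continuous fun ω : ℕ → Fin 3 => g a (l (shift 1 ω)) := fun a =>
      (hgc a).comp_continuous (hlcont.comp (continuous_shift 1)) fun ω => hlS _
    exact continuous_of_letter (h := fun a ω => g a (l (shift 1 ω))) h1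
  · obtain ⟨N, hN⟩ := hunif ε hε
    have hC0 : 0 ≤ C := (abs_nonneg _).trans (hC 0 _ (hlS fun _ => 0))
    -- Each step costs at most `ε` once the remaining word has length at least `N`, and at most `2 *
    -- C` for the shorter words; `min n N` counts the latter.
    have key : ∀ n ω, |Real.log (l1norm ((prefixProd (matrices e) ω n).mulVec c)) -
        ∑ k ∈ Finset.range n, G (shift k ω)| ≤
        |Real.log (l1norm c)| + 2 * C * min (n : ℝ) N + ε * n := by
      intro n
      induction n with
      | zero => intro ω; simp [prefixProd]
      | succ n ih =>
        intro ω
        have e1 : Real.log (l1norm ((prefixProd (matrices e) ω (n + 1)).mulVec c)) =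
            Real.log (l1norm ((prefixProd (matrices e) (shift 1 ω) n).mulVec c)) +
              g (ω 0) (F n (shift 1 ω)) := by
          have h1 := l1norm_pos (hne n (shift 1 ω))
          rw [hg, ← Real.log_mul h1.ne' (hSpos _ _ (hFS n _)).ne']
          congr 1
          rw [prefixProd_succ', ← Matrix.mulVec_mulVec,
            ← l1norm_smul_normalized ((prefixProd (matrices e) (shift 1 ω) n).mulVec c),
            Matrix.mulVec_smul, l1norm_smul, abs_of_pos h1, l1norm_smul_normalized]
        have e2 : ∑ k ∈ Finset.range (n + 1), G (shift k ω) =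
            ∑ k ∈ Finset.range n, G (shift k (shift 1 ω)) + g (ω 0) (l (shift 1 ω)) := by
          rw [Finset.sum_range_succ']
          simp only [shift_shift, add_comm 1]
          rfl
        have e3 := ih (shift 1 ω)
        have e4 : |g (ω 0) (F n (shift 1 ω)) - g (ω 0) (l (shift 1 ω))| ≤
            2 * C * (min ((n : ℝ) + 1) N - min (n : ℝ) N) + ε := by
          rcases le_or_gt N n with h | h
          · have h3 : (N : ℝ) ≤ n := by exact_mod_cast h
            rw [min_eq_right h3, min_eq_right (by linarith)]
            have := hN n h (ω 0) (shift 1 ω)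
            linarith
          · have h3 : (n : ℝ) + 1 ≤ N := by exact_mod_cast h
            rw [min_eq_left h3, min_eq_left (by linarith)]
            have h4 := abs_sub (g (ω 0) (F n (shift 1 ω))) (g (ω 0) (l (shift 1 ω)))
            have h5 := hC (ω 0) _ (hFS n (shift 1 ω))
            have h6 := hC (ω 0) _ (hlS (shift 1 ω))
            linarith
        rw [e1, e2]
        push_cast at e3 e4 ⊢
        rw [abs_le] at *
        constructor <;> linarith
    refine ⟨|Real.log (l1norm c)| + 2 * C * N, fun n ω => (key n ω).trans ?_⟩
    have : min (n : ℝ) N ≤ N := min_le_right _ _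
    gcongr

end

/-- If the logarithm of the quotient in the definition of the weak Gibbs property is `o(n)`
uniformly, the property holds. -/
lemma isWeakGibbs_of_log {b : ℕ} {ν : Measure (ℕ → Fin b)} {Φ : (ℕ → Fin b) → ℝ}
    (hΦ : Continuous Φ) (hpos : ∀ ω n, 0 < ν.real (PiNat.cylinder ω (n + 1)))
    (h : ∀ ε > 0, ∃ A, ∀ n ω, |Real.log (ν.real (PiNat.cylinder ω (n + 1))) -
      ∑ k ∈ Finset.range (n + 1), Φ (shift k ω)| ≤ A + ε * n) : IsWeakGibbs ν := by
  refine ⟨Φ, hΦ, Metric.tendstoUniformly_iff.2 fun ε hε => ?_⟩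
  set δ := min 1 (ε / 3) with hδ
  have hδ0 : 0 < δ := lt_min one_pos (by positivity)
  obtain ⟨A, hA⟩ := h (δ / 2) (half_pos hδ0)
  obtain ⟨N, hN⟩ := exists_nat_gt (2 * A / δ)
  filter_upwards [eventually_ge_atTop (N + 1)] with n hn ω
  obtain ⟨n, rfl⟩ : ∃ k, n = k + 1 := ⟨n - 1, by omega⟩
  set E := Real.log (ν.real (PiNat.cylinder ω (n + 1))) -
    ∑ k ∈ Finset.range (n + 1), Φ (shift k ω) with hE
  have hn0 : (0 : ℝ) < n + 1 := by positivity
  have e1 : (ν.real (PiNat.cylinder ω (n + 1)) /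
      Real.exp (∑ k ∈ Finset.range (n + 1), Φ (shift k ω))) ^ (1 / ((n + 1 : ℕ) : ℝ)) =
      Real.exp (E / (n + 1)) := by
    rw [← Real.exp_log (hpos ω n), ← Real.exp_sub, ← hE, ← Real.exp_mul]
    push_cast
    congr 1
    ring
  have e2 : |E / (n + 1)| ≤ δ := by
    rw [abs_div, abs_of_pos hn0, div_le_iff₀ hn0]
    refine (hA n ω).trans ?_
    rw [div_lt_iff₀ hδ0] at hN
    have : (N : ℝ) ≤ n := by exact_mod_cast Nat.le_of_succ_le_succ hn
    nlinarith
  rw [e1, dist_comm, Real.dist_eq]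
  calc |Real.exp (E / (n + 1)) - 1| ≤ 2 * |E / (n + 1)| :=
        Real.abs_exp_sub_one_le (e2.trans (min_le_left _ _))
    _ ≤ 2 * (ε / 3) := by gcongr; exact e2.trans (min_le_right _ _)
    _ < ε := by linarith

/-- A measure whose values on the cylinders are given by products of the matrices has the weak
Gibbs property. -/
theorem isWeakGibbs_of_matrices {e : ℝ} (he : e = 0 ∨ e = 1) {c : Fin 7 → ℝ} (hc : ∀ i, 0 < c i)
    (κ : Fin 3 → ℝ) {ν : Measure (ℕ → Fin 3)}
    (hν : ∀ ω n, ν.real (PiNat.cylinder ω (n + 1)) =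
      Real.exp (∑ k ∈ Finset.range (n + 1), κ (ω k)) *
        (prefixProd (matrices e) (shift 1 ω) n).mulVec c ((![0, 2, 4] : Fin 3 → Fin 7) (ω 0))) :
    IsWeakGibbs ν := by
  obtain ⟨G, hG, ⟨C, hC⟩, happ⟩ := exists_birkhoff_approx he hc
  obtain ⟨t, ht, hcK⟩ := exists_mem_cone hc
  choose B hB0 hB using fun a => exists_l1norm_le_coord he hc a
  obtain ⟨a0, ha0⟩ := Finite.exists_max B
  have hs : ∀ n η, 0 < l1norm ((prefixProd (matrices e) η n).mulVec c) := fun n η =>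
    l1norm_pos (orbit_mem_cone he ht hcK η n).2
  have hnn : ∀ n η i, 0 ≤ (prefixProd (matrices e) η n).mulVec c i := fun n η i =>
    (orbit_mem_cone he ht hcK η n).1.1 i
  have hB' : ∀ a n η, l1norm ((prefixProd (matrices e) η n).mulVec c) ≤ B a0 * (n + 1) *
      (prefixProd (matrices e) η n).mulVec c ((![0, 2, 4] : Fin 3 → Fin 7) a) := fun a n η =>
    (hB a η n).trans (by
      have := hnn n η ((![0, 2, 4] : Fin 3 → Fin 7) a)
      gcongr
      exact ha0 a)
  have hcoord : ∀ a n η, 0 <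
      (prefixProd (matrices e) η n).mulVec c ((![0, 2, 4] : Fin 3 → Fin 7) a) := fun a n η => by
    have h1 := (hs n η).trans_le (hB' a n η)
    have h2 : 0 < B a0 * (n + 1 : ℝ) := mul_pos (hB0 a0) (by positivity)
    exact (pos_iff_pos_of_mul_pos h1).1 h2
  refine isWeakGibbs_of_log (Φ := fun ω => G ω + κ (ω 0))
    (hG.add (continuous_of_discreteTopology.comp (continuous_apply 0)))
    (fun ω n => by rw [hν]; exact mul_pos (Real.exp_pos _) (hcoord _ _ _)) fun ε hε => ?_
  obtain ⟨A, hA⟩ := happ (ε / 2) (half_pos hε)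
  refine ⟨A + C + |Real.log (B a0)| + ε / 2 + |Real.log (ε / 2)|, fun n ω => ?_⟩
  have h1 := hcoord (ω 0) n (shift 1 ω)
  set z := (prefixProd (matrices e) (shift 1 ω) n).mulVec c ((![0, 2, 4] : Fin 3 → Fin 7) (ω 0))
    with hz
  set s := l1norm ((prefixProd (matrices e) (shift 1 ω) n).mulVec c) with hsdef
  have hs0 : 0 < s := hs n _
  have e1 : Real.log (ν.real (PiNat.cylinder ω (n + 1))) =
      ∑ k ∈ Finset.range (n + 1), κ (ω k) + Real.log z := by
    rw [hν, Real.log_mul (Real.exp_pos _).ne' h1.ne', Real.log_exp]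
  have e2 : ∑ k ∈ Finset.range (n + 1), (G (shift k ω) + κ (shift k ω 0)) =
      ∑ k ∈ Finset.range n, G (shift k (shift 1 ω)) + G ω +
        ∑ k ∈ Finset.range (n + 1), κ (ω k) := by
    rw [Finset.sum_add_distrib, Finset.sum_range_succ']
    simp only [shift_shift, add_comm 1]
    congr 1
    exact Finset.sum_congr rfl fun k _ => by simp [shift]
  have e3 : Real.log z ≤ Real.log s := Real.log_le_log h1 <|
    (le_abs_self _).trans
      (abs_le_l1norm ((prefixProd (matrices e) (shift 1 ω) n).mulVec c) _)
  have hn0 : (0 : ℝ) < n + 1 := by positivity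
  have e4 : Real.log s ≤ Real.log (B a0) + Real.log (n + 1) + Real.log z := by
    rw [← Real.log_mul (hB0 a0).ne' hn0.ne', ← Real.log_mul (mul_pos (hB0 a0) hn0).ne' h1.ne']
    exact Real.log_le_log hs0 (hB' _ _ _)
  -- The inequality `log x ≤ x - 1` at `x = ε / 2 * (n + 1)` makes the polynomial loss of the
  -- coordinate negligible.
  have e5 : Real.log (n + 1) ≤ ε / 2 * (n + 1) - Real.log (ε / 2) := by
    have h2 := Real.log_le_sub_one_of_pos (mul_pos (half_pos hε) hn0)
    rw [Real.log_mul (half_pos hε).ne' hn0.ne'] at h2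
    linarith
  have e6 := abs_le.1 (hA n (shift 1 ω))
  have e7 := abs_le.1 (hC ω)
  have e8 := neg_abs_le (Real.log (ε / 2))
  have e9 := le_abs_self (Real.log (B a0))
  have e10 := abs_nonneg (Real.log (ε / 2))
  have e11 := abs_nonneg (Real.log (B a0))
  rw [e1, e2, abs_le]
  constructor <;> nlinarith


/-! ### Self-similarity of the Bernoulli convolution -/

/-- The sequence `a, ω_0, ω_1, …`. -/
def consSeq {α : Type*} (p : α × (ℕ → α)) : ℕ → α := fun n => n.casesOn p.1 p.2

lemma measurable_consSeq {α : Type*} [MeasurableSpace α] :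
    Measurable (consSeq : α × (ℕ → α) → ℕ → α) := by
  refine measurable_pi_lambda _ fun n => ?_
  cases n with
  | zero => exact measurable_fst
  | succ n => exact (measurable_pi_apply n).comp measurable_snd

/-- Putting an independent digit in front of an independent sequence does not change the law; this
is the source of self-similarity. It suffices to compare boxes, whose preimages are again boxes. -/
lemma map_consSeq_infinitePi {α : Type*} [MeasurableSpace α] (p : Measure α)
    [IsProbabilityMeasure p] :
    (p.prod (Measure.infinitePi fun _ : ℕ => p)).map consSeq =
      Measure.infinitePi fun _ : ℕ => p := by
  classical
  refine Measure.eq_infinitePi _ fun s t ht => ?_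
  obtain ⟨N, hN⟩ : ∃ N, s ⊆ Finset.range (N + 1) :=
    ⟨s.sup id, fun i hi => Finset.mem_range_succ_iff.2 (Finset.le_sup (f := id) hi)⟩
  -- Filling the missing indices with `univ` replaces `s` by an initial segment, from which the
  -- factor of index 0 splits off.
  set t' : ℕ → Set α := fun i => if i ∈ s then t i else univ with ht'
  have hm : ∀ i, MeasurableSet (t' i) := fun i => by
    simp only [ht']; split_ifs; exacts [ht i, MeasurableSet.univ]
  have hpre : consSeq ⁻¹' ((s : Set ℕ).pi t) =
      t' 0 ×ˢ ((Finset.range N : Set ℕ).pi fun i => t' (i + 1)) := by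
    ext ⟨a, ω⟩
    simp only [mem_preimage, Set.mem_pi, Finset.mem_coe, mem_prod, ht']
    constructor
    · intro h
      refine ⟨?_, fun i _ => ?_⟩
      · split_ifs with h0
        exacts [h 0 h0, mem_univ _]
      · split_ifs with h0
        exacts [h (i + 1) h0, mem_univ _]
    · rintro ⟨h0, h1⟩ i hi
      cases i with
      | zero => simpa [hi, consSeq] using h0
      | succ i =>
        have := h1 i (by have := Finset.mem_range.1 (hN hi); simp; omega)
        simpa [hi, consSeq] using this
  rw [Measure.map_apply measurable_consSeq
      (MeasurableSet.pi s.countable_toSet fun i _ => ht i), hpre, Measure.prod_prod,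
    Measure.infinitePi_pi _ fun i _ => hm _]
  have e1 : ∏ i ∈ Finset.range (N + 1), p (t' i) = ∏ i ∈ s, p (t i) := by
    rw [← Finset.prod_subset hN fun i _ hi => by simp [ht', hi]]
    exact Finset.prod_congr rfl fun i hi => by simp [ht', hi]
  rw [← e1, Finset.prod_range_succ', mul_comm]

lemma summable_digit_bound {β : ℝ} (hβ : 1 < β) : Summable fun n : ℕ => 1 / β ^ (n + 1) := by
  have h := (summable_geometric_of_lt_one (inv_nonneg.2 (zero_le_one.trans hβ.le))
    (inv_lt_one_of_one_lt₀ hβ)).mul_left β⁻¹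
  refine h.congr fun n => ?_
  rw [pow_succ, one_div, mul_inv, inv_pow]; ring

lemma tsum_digit_bound {β : ℝ} (hβ : 1 < β) : ∑' n : ℕ, 1 / β ^ (n + 1) = 1 / (β - 1) := by
  have h0 : β ≠ 0 := by linarith
  have h1 : β - 1 ≠ 0 := by linarith
  have h : ∀ n : ℕ, 1 / β ^ (n + 1) = β⁻¹ * β⁻¹ ^ n := fun n => by
    rw [pow_succ, one_div, mul_inv, inv_pow]; ring
  rw [tsum_congr h, tsum_mul_left, tsum_geometric_of_lt_one
    (inv_nonneg.2 (zero_le_one.trans hβ.le)) (inv_lt_one_of_one_lt₀ hβ)]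
  have h2 : 1 - β⁻¹ ≠ 0 := by
    have := inv_lt_one_of_one_lt₀ hβ
    linarith
  field_simp

lemma digit_le {β : ℝ} (hβ : 1 < β) (ω : ℕ → Fin (1 + 1)) (n : ℕ) :
    ((ω n : ℕ) : ℝ) / β ^ (n + 1) ≤ 1 / β ^ (n + 1) := by
  have : ((ω n : ℕ) : ℝ) ≤ 1 := by exact_mod_cast Nat.le_of_lt_succ (ω n).2
  have h0 : 0 < β := by linarith
  gcongr

lemma summable_digits {β : ℝ} (hβ : 1 < β) (ω : ℕ → Fin (1 + 1)) :
    Summable fun n : ℕ => ((ω n : ℕ) : ℝ) / β ^ (n + 1) :=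
  (summable_digit_bound hβ).of_nonneg_of_le
    (fun n => div_nonneg (Nat.cast_nonneg _) (pow_nonneg (by linarith) _)) (digit_le hβ ω)

lemma continuous_tsum_digits {β : ℝ} (hβ : 1 < β) :
    Continuous fun ω : ℕ → Fin (1 + 1) => ∑' n : ℕ, ((ω n : ℕ) : ℝ) / β ^ (n + 1) := by
  refine continuous_tsum (fun n => ?_) (summable_digit_bound hβ) fun n ω => ?_
  · have h : Continuous fun a : Fin (1 + 1) => ((a : ℕ) : ℝ) / β ^ (n + 1) :=
      continuous_of_discreteTopology
    exact h.comp (continuous_apply n)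
  · rw [Real.norm_of_nonneg (div_nonneg (Nat.cast_nonneg _) (pow_nonneg (by linarith) _))]
    exact digit_le hβ ω n

lemma tsum_digits_consSeq {β : ℝ} (hβ : 1 < β) (p : Fin (1 + 1) × (ℕ → Fin (1 + 1))) :
    ∑' n : ℕ, (((consSeq p n : Fin (1 + 1)) : ℕ) : ℝ) / β ^ (n + 1) =
      (((p.1 : ℕ) : ℝ) + ∑' n : ℕ, ((p.2 n : ℕ) : ℝ) / β ^ (n + 1)) / β := by
  rw [(summable_digits hβ (consSeq p)).tsum_eq_zero_add, add_div, ← tsum_div_const]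
  congr 1
  · simp [consSeq]
  · refine tsum_congr fun n => ?_
    rw [pow_succ _ (n + 1), ← div_div]
    rfl

lemma isProbabilityMeasure_rescaled {β : ℝ} (hβ : 1 < β) : IsProbabilityMeasure (rescaledBernoulliConvolution β) := by
  unfold rescaledBernoulliConvolution fairBernoulliConvolution bernoulliConvolution
  have h := (continuous_tsum_digits hβ).measurable.aemeasurable
    (μ := Measure.infinitePi fun _ : ℕ => (PMF.uniformOfFintype (Fin (1 + 1))).toMeasure)
  have := Measure.isProbabilityMeasure_map h
  exact Measure.isProbabilityMeasure_map (measurable_const_mul (β - 1)).aemeasurable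

lemma rescaled_apply {β : ℝ} (hβ : 1 < β) {A : Set ℝ} (hA : MeasurableSet A) :
    rescaledBernoulliConvolution β A =
      (Measure.infinitePi fun _ : ℕ => (PMF.uniformOfFintype (Fin (1 + 1))).toMeasure)
        {ω | (β - 1) * ∑' n : ℕ, ((ω n : ℕ) : ℝ) / β ^ (n + 1) ∈ A} := by
  unfold rescaledBernoulliConvolution fairBernoulliConvolution bernoulliConvolution
  rw [Measure.map_apply (measurable_const_mul _) hA,
    Measure.map_apply (continuous_tsum_digits hβ).measurable (measurable_const_mul _ hA)]
  rfl

lemma rescaled_ae_mem {β : ℝ} (hβ : 1 < β) : ∀ᵐ x ∂(rescaledBernoulliConvolution β), x ∈ Icc (0 : ℝ) 1 := by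
  rw [ae_iff]
  have : {x : ℝ | x ∉ Icc (0 : ℝ) 1} = (Icc 0 1)ᶜ := rfl
  rw [this, rescaled_apply hβ measurableSet_Icc.compl]
  refine (congrArg _ ?_).trans measure_empty
  refine eq_empty_of_forall_notMem fun ω hω => hω ⟨?_, ?_⟩
  · exact mul_nonneg (by linarith) (tsum_nonneg fun n =>
      div_nonneg (Nat.cast_nonneg _) (pow_nonneg (by linarith) _))
  · have h := (summable_digits hβ ω).tsum_le_tsum (digit_le hβ ω) (summable_digit_bound hβ)
    rw [tsum_digit_bound hβ] at h
    calc _ ≤ (β - 1) * (1 / (β - 1)) := mul_le_mul_of_nonneg_left h (by linarith)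
      _ = 1 := by
        have : β - 1 ≠ 0 := by linarith
        field_simp

/-- The self-similarity equation. -/
lemma rescaled_selfSimilar {β : ℝ} (hβ : 1 < β) {A : Set ℝ} (hA : MeasurableSet A) :
    (rescaledBernoulliConvolution β).real A =
      1 / 2 * (rescaledBernoulliConvolution β).real ((fun x => x / β) ⁻¹' A) +
        1 / 2 * (rescaledBernoulliConvolution β).real ((fun x => ((β - 1) + x) / β) ⁻¹' A) := by
  set Y : (ℕ → Fin (1 + 1)) → ℝ := fun ω => ∑' n : ℕ, ((ω n : ℕ) : ℝ) / β ^ (n + 1) with hY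
  have hYm : Measurable Y := (continuous_tsum_digits hβ).measurable
  set p : Measure (Fin (1 + 1)) := (PMF.uniformOfFintype (Fin (1 + 1))).toMeasure with hp
  have hpa : ∀ a, p {a} = 2⁻¹ := fun a => by
    rw [hp, PMF.toMeasure_apply_singleton _ _ (measurableSet_singleton a)]
    simp
  have hms : MeasurableSet {ω | (β - 1) * Y ω ∈ A} := (hYm.const_mul _) hA
  have m1 : Measurable fun x : ℝ => x / β := measurable_id.div_const _
  have m2 : Measurable fun x : ℝ => ((β - 1) + x) / β := (measurable_const_add _).div_const _
  have key : rescaledBernoulliConvolution β A =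
      rescaledBernoulliConvolution β ((fun x => x / β) ⁻¹' A) * 2⁻¹ +
        rescaledBernoulliConvolution β ((fun x => ((β - 1) + x) / β) ⁻¹' A) * 2⁻¹ := by
    rw [rescaled_apply hβ hA, rescaled_apply hβ (m1 hA), rescaled_apply hβ (m2 hA)]
    conv_lhs => rw [← map_consSeq_infinitePi p]
    rw [Measure.map_apply measurable_consSeq hms, Measure.prod_apply (measurable_consSeq hms),
      lintegral_fintype]
    change ∑ a : Fin 2, _ = _
    rw [Fin.sum_univ_two, hpa, hpa]
    congr 3
    · ext ω
      simp only [mem_preimage, mem_ofPred_eq, hY, tsum_digits_consSeq hβ]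
      simp only [Fin.isValue, Fin.val_zero, Nat.cast_zero, zero_add, mul_div_assoc]
    · ext ω
      simp only [mem_preimage, mem_ofPred_eq, hY, tsum_digits_consSeq hβ]
      rw [← mul_div_assoc, mul_add]
      simp
  have := isProbabilityMeasure_rescaled hβ
  rw [Measure.real, key, ENNReal.toReal_add (by finiteness) (by finiteness), ENNReal.toReal_mul,
    ENNReal.toReal_mul, Measure.real, Measure.real]
  simp
  ring

/-! ### Masses of half-open intervals -/

lemma rescaled_Ico {β : ℝ} (hβ : 1 < β) (x y : ℝ) :
    (rescaledBernoulliConvolution β).real (Ico x y) =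
      1 / 2 * (rescaledBernoulliConvolution β).real (Ico (β * x) (β * y)) +
        1 / 2 * (rescaledBernoulliConvolution β).real
          (Ico (β * x - (β - 1)) (β * y - (β - 1))) := by
  have h0 : 0 < β := by linarith
  rw [rescaled_selfSimilar hβ measurableSet_Ico]
  congr 3
  · ext z
    simp only [mem_preimage, mem_Ico, le_div_iff₀ h0, div_lt_iff₀ h0, mul_comm]
  · ext z
    simp only [mem_preimage, mem_Ico, le_div_iff₀ h0, div_lt_iff₀ h0]
    constructor <;> rintro ⟨h1, h2⟩ <;> constructor <;> linarith

/-- The two preimages of 1 are `β`, which is outside `[0, 1]`, and 1 itself; hence the mass of 1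
equals half of itself. -/
lemma rescaled_singleton_one {β : ℝ} (hβ : 1 < β) : (rescaledBernoulliConvolution β).real {1} = 0 := by
  have h0 : 0 < β := by linarith
  have hz : (rescaledBernoulliConvolution β).real {β} = 0 := by
    have h := measure_mono_null (t := {x : ℝ | x ∉ Icc (0 : ℝ) 1}) (s := {β})
      (by rintro x rfl; exact fun h => by linarith [h.2]) (ae_iff.1 (rescaled_ae_mem hβ))
    simp [Measure.real, h]
  have h := rescaled_selfSimilar hβ (measurableSet_singleton (1 : ℝ))
  have e1 : (fun x => x / β) ⁻¹' {(1 : ℝ)} = {β} := by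
    ext x; simp [div_eq_iff h0.ne']
  have e2 : (fun x => ((β - 1) + x) / β) ⁻¹' {(1 : ℝ)} = {1} := by
    ext x
    simp only [mem_preimage, mem_singleton_iff, div_eq_iff h0.ne']
    constructor <;> intro h <;> linarith
  rw [e1, e2, hz] at h
  linarith

lemma rescaled_Ico_eq_zero_of_le {β : ℝ} (hβ : 1 < β) {x y : ℝ} (hy : y ≤ 0) :
    (rescaledBernoulliConvolution β).real (Ico x y) = 0 := by
  have h := measure_mono_null (t := {x : ℝ | x ∉ Icc (0 : ℝ) 1}) (s := Ico x y)
    (fun z hz h => by linarith [h.1, hz.2]) (ae_iff.1 (rescaled_ae_mem hβ))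
  simp [Measure.real, h]

/-- The equality case `x = 1`, where the absence of an atom at 1 matters, does occur among the
translates met later. -/
lemma rescaled_Ico_eq_zero_of_ge {β : ℝ} (hβ : 1 < β) {x y : ℝ} (hx : 1 ≤ x) :
    (rescaledBernoulliConvolution β).real (Ico x y) = 0 := by
  have := isProbabilityMeasure_rescaled hβ
  have h1 : rescaledBernoulliConvolution β {1} = 0 := by
    have := rescaled_singleton_one hβ
    rwa [Measure.real, ENNReal.toReal_eq_zero_iff, or_iff_left (measure_ne_top _ _)] at this
  have h := measure_mono_null (t := {x : ℝ | x ∉ Icc (0 : ℝ) 1} ∪ {1}) (s := Ico x y)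
    (fun z hz => by
      by_cases h : z = 1
      · exact Or.inr h
      · refine Or.inl fun h' => h (le_antisymm h'.2 (hx.trans hz.1)))
    (measure_union_null (ae_iff.1 (rescaled_ae_mem hβ)) h1)
  simp [Measure.real, h]

lemma rescaled_Ico_zero_one {β : ℝ} (hβ : 1 < β) : rescaledBernoulliConvolution β (Ico 0 1) = 1 := by
  have := isProbabilityMeasure_rescaled hβ
  have h1 : rescaledBernoulliConvolution β {1} = 0 := by
    have := rescaled_singleton_one hβ
    rwa [Measure.real, ENNReal.toReal_eq_zero_iff, or_iff_left (measure_ne_top _ _)] at this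
  rw [prob_compl_eq_zero_iff measurableSet_Ico |>.symm]
  refine measure_mono_null (t := {x : ℝ | x ∉ Icc (0 : ℝ) 1} ∪ {1}) (fun z hz => ?_)
    (measure_union_null (ae_iff.1 (rescaled_ae_mem hβ)) h1)
  by_cases h : z = 1
  · exact Or.inr h
  · exact Or.inl fun h' => hz ⟨h'.1, lt_of_le_of_ne h'.2 h⟩


/-! ### The base -/

/-- The precision serves to decide on which side of `[0, 1)` the translated intervals lie. -/
lemma base_mem {β : ℝ} (h : β ^ 3 = 2 * β ^ 2 - β + 1) : 1.7548 < β ∧ β < 1.7549 := by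
  constructor
  · by_contra! hle
    nlinarith [sq_nonneg (β - 1), sq_nonneg (β - 2 / 5), sq_nonneg β]
  · by_contra! hle
    nlinarith [mul_nonneg (sub_nonneg.2 hle) (sq_nonneg (β - 1)), sq_nonneg (β - 1)]

lemma base_sq_mem {β : ℝ} (h : β ^ 3 = 2 * β ^ 2 - β + 1) : 3.079 < β ^ 2 ∧ β ^ 2 < 3.08 := by
  obtain ⟨h1, h2⟩ := base_mem h
  constructor <;> nlinarith

lemma wordMap_cons (β : ℝ) (d : ℕ) (w : List ℕ) (x : ℝ) :
    wordMap β (d :: w) x = (d + wordMap β w x) / β := rfl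

lemma wordMap_mono {β : ℝ} (hβ : 0 < β) (w : List ℕ) : Monotone (wordMap β w) := by
  induction w with
  | nil => exact monotone_id
  | cons d w ih =>
    intro x y hxy
    rw [wordMap_cons, wordMap_cons]
    have := ih hxy
    gcongr

/-- The endpoints of the images of `[0, 1)` under the suffixes of the words `0`, `10`, `1100`. -/
lemma wordMap_zero_one {β : ℝ} (h : β ^ 3 = 2 * β ^ 2 - β + 1) :
    (wordMap β [] 0 = 0 ∧ wordMap β [0] 0 = 0 ∧ wordMap β [0, 0] 0 = 0 ∧
      wordMap β [1, 0] 0 = β ^ 2 - 2 * β + 1 ∧ wordMap β [1, 0, 0] 0 = β ^ 2 - 2 * β + 1 ∧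
      wordMap β [1, 1, 0, 0] 0 = 2 * β ^ 2 - 3 * β) ∧
    (wordMap β [] 1 = 1 ∧ wordMap β [0] 1 = β ^ 2 - 2 * β + 1 ∧
      wordMap β [0, 0] 1 = β ^ 2 - β - 1 ∧ wordMap β [1, 0] 1 = 2 * β ^ 2 - 3 * β ∧
      wordMap β [1, 0, 0] 1 = β - 1 ∧ wordMap β [1, 1, 0, 0] 1 = 1) := by
  have h0 : β ≠ 0 := by linarith [(base_mem h).1]
  have a0 : wordMap β [] 0 = 0 := rfl
  have a1 : wordMap β [0] 0 = 0 := by simp [wordMap_cons, a0]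
  have a2 : wordMap β [0, 0] 0 = 0 := by rw [wordMap_cons, a1]; simp
  have a3 : wordMap β [1, 0] 0 = β ^ 2 - 2 * β + 1 := by
    rw [wordMap_cons, a1, div_eq_iff h0]; push_cast; linear_combination -h
  have a4 : wordMap β [1, 0, 0] 0 = β ^ 2 - 2 * β + 1 := by
    rw [wordMap_cons, a2, div_eq_iff h0]; push_cast; linear_combination -h
  have a5 : wordMap β [1, 1, 0, 0] 0 = 2 * β ^ 2 - 3 * β := by
    rw [wordMap_cons, a4, div_eq_iff h0]; push_cast; linear_combination -2 * h
  have b0 : wordMap β [] 1 = 1 := rfl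
  have b1 : wordMap β [0] 1 = β ^ 2 - 2 * β + 1 := by
    rw [wordMap_cons, b0, div_eq_iff h0]; push_cast; linear_combination -h
  have b2 : wordMap β [0, 0] 1 = β ^ 2 - β - 1 := by
    rw [wordMap_cons, b1, div_eq_iff h0]; push_cast; linear_combination -h
  have b3 : wordMap β [1, 0] 1 = 2 * β ^ 2 - 3 * β := by
    rw [wordMap_cons, b1, div_eq_iff h0]; push_cast; linear_combination -2 * h
  have b4 : wordMap β [1, 0, 0] 1 = β - 1 := by
    rw [wordMap_cons, b2, div_eq_iff h0]; push_cast; ring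
  have b5 : wordMap β [1, 1, 0, 0] 1 = 1 := by
    rw [wordMap_cons, b4, div_eq_iff h0]; push_cast; ring
  exact ⟨⟨a0, a1, a2, a3, a4, a5⟩, b0, b1, b2, b3, b4, b5⟩

/-! ### The masses of the translates of the basic intervals -/

/-- The mass of the translate by `a + b β + c β ^ 2` of the image of `[p, q)` under the map
associated to the word `w`. -/
noncomputable def translateMass (β p q : ℝ) (w : List ℕ) (a b c : ℝ) : ℝ :=
  (rescaledBernoulliConvolution β).real
    (Ico (wordMap β w p + (a + b * β + c * β ^ 2)) (wordMap β w q + (a + b * β + c * β ^ 2)))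

/-- Self-similarity multiplies the interval by `β`, which removes the first letter of the word; `β ^
3 = 2 * β ^ 2 - β + 1` rewrites the new translation as a combination of `1, β, β ^ 2`. The second
branch subtracts `β - 1`. -/
lemma translateMass_cons {β : ℝ} (h : β ^ 3 = 2 * β ^ 2 - β + 1) (p q : ℝ) (d : ℕ) (w : List ℕ)
    (a b c : ℝ) :
    translateMass β p q (d :: w) a b c =
      1 / 2 * translateMass β p q w (c + d) (a - c) (b + 2 * c) +
        1 / 2 * translateMass β p q w (c + d + 1) (a - c - 1) (b + 2 * c) := by
  obtain ⟨h1, -⟩ := base_mem h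
  have h0 : β ≠ 0 := by linarith
  have e : ∀ x, β * (wordMap β (d :: w) x + (a + b * β + c * β ^ 2)) =
      wordMap β w x + (c + d + (a - c) * β + (b + 2 * c) * β ^ 2) := fun x => by
    rw [wordMap_cons, mul_add, mul_div_cancel₀ _ h0]
    linear_combination c * h
  have e' : ∀ x, β * (wordMap β (d :: w) x + (a + b * β + c * β ^ 2)) - (β - 1) =
      wordMap β w x + (c + d + 1 + (a - c - 1) * β + (b + 2 * c) * β ^ 2) := fun x => by
    rw [e]; ring
  rw [translateMass, rescaled_Ico (by linarith), e', e', e, e]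
  rfl

lemma translateMass_eq_zero_of_le {β : ℝ} (hβ : 1 < β) {p q : ℝ} (hq : q ≤ 1) {w : List ℕ}
    {a b c : ℝ} (h : wordMap β w 1 + (a + b * β + c * β ^ 2) ≤ 0) :
    translateMass β p q w a b c = 0 := by
  have := wordMap_mono (zero_lt_one.trans hβ) w hq
  exact rescaled_Ico_eq_zero_of_le hβ (by linarith)

lemma translateMass_eq_zero_of_ge {β : ℝ} (hβ : 1 < β) {p q : ℝ} (hp : 0 ≤ p) {w : List ℕ}
    {a b c : ℝ} (h : 1 ≤ wordMap β w 0 + (a + b * β + c * β ^ 2)) :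
    translateMass β p q w a b c = 0 := by
  have := wordMap_mono (zero_lt_one.trans hβ) w hp
  exact rescaled_Ico_eq_zero_of_ge hβ (by linarith)

/-- The vector of masses that is transformed linearly by the matrices. -/
noncomputable def massVec (β : ℝ) (w : List ℕ) (p q : ℝ) : Fin 7 → ℝ :=
  let V := translateMass β p q w
  ![V 0 0 0 + V 1 (-1) 0, V 2 (-1) 0, V 0 2 (-1) + V 1 1 (-1), V (-1) 2 (-1),
    V 0 0 0 + V (-1) 1 0, V 0 2 (-1), V 1 (-2) 1]

lemma massVec_wordMap (β : ℝ) (w : List ℕ) (p q : ℝ) :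
    massVec β [] (wordMap β w p) (wordMap β w q) = massVec β w p q := rfl

/-- Each translate is expanded by self-similarity until the word is exhausted, and terms lying
outside `[0, 1)` are dropped. What survives is a combination of the entries of `massVec β [] p q`.
-/
lemma massVec_word_zero {β : ℝ} (h : β ^ 3 = 2 * β ^ 2 - β + 1) {p q : ℝ} (hp : 0 ≤ p)
    (hq : q ≤ 1) :
    massVec β [0] p q = (1 / 2 : ℝ) ^ 1 • (M₀).mulVec (massVec β [] p q) ∧
      translateMass β p q [0] 0 0 0 = (1 / 2 : ℝ) ^ 1 * massVec β [] p q 0 := by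
  obtain ⟨b1, b2⟩ := base_mem h
  obtain ⟨s1, s2⟩ := base_sq_mem h
  obtain ⟨⟨x0, x1, x2, x3, x4, x5⟩, y0, y1, y2, y3, y4, y5⟩ := wordMap_zero_one h
  have st := fun d w a b c => translateMass_cons h p q d w a b c
  have lo := fun {w a b c} => translateMass_eq_zero_of_le (by linarith : 1 < β) (p := p) hq
    (w := w) (a := a) (b := b) (c := c)
  have hi := fun {w a b c} => translateMass_eq_zero_of_ge (by linarith : 1 < β) (q := q) hp
    (w := w) (a := a) (b := b) (c := c)
  rw [M₀_mulVec]
  unfold massVec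
  generalize translateMass β p q = V at *
  have h0 : V [0] 0 0 0 = 1 / 2 * V [] 0 0 0 + 1 / 2 * V [] 1 (-1) 0 := by norm_num [st]
  have h1 : V [0] 1 (-1) 0 = 0 := lo (by linarith)
  have h2 : V [0] 0 2 (-1) = 1 / 2 * V [] (-1) 1 0 + 1 / 2 * V [] 0 0 0 := by norm_num [st]
  have h3 : V [0] 1 1 (-1) = 1 / 2 * V [] (-1) 2 (-1) + 1 / 2 * V [] 0 1 (-1) := by norm_num [st]
  have h4 : V [] 0 1 (-1) = 0 := lo (by linarith)
  have h5 : V [0] (-1) 1 0 = 1 / 2 * V [] 0 (-1) 1 + 1 / 2 * V [] 1 (-2) 1 := by norm_num [st]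
  have h6 : V [] 0 (-1) 1 = 0 := hi (by linarith)
  have h7 : V [0] (-1) 2 (-1) = 0 := lo (by linarith)
  have h8 : V [0] 1 (-2) 1 = 1 / 2 * V [] 1 0 0 + 1 / 2 * V [] 2 (-1) 0 := by norm_num [st]
  have h9 : V [] 1 0 0 = 0 := hi (by linarith)
  have h10 : V [0] 2 (-1) 0 = 1 / 2 * V [] 0 2 (-1) + 1 / 2 * V [] 1 1 (-1) := by norm_num [st]
  refine ⟨?_, ?_⟩
  · ext i
    fin_cases i <;> simp <;> linarith
  · simp
    linarith

lemma massVec_word_one {β : ℝ} (h : β ^ 3 = 2 * β ^ 2 - β + 1) {p q : ℝ} (hp : 0 ≤ p)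
    (hq : q ≤ 1) :
    massVec β [1, 0] p q = (1 / 2 : ℝ) ^ 2 • (M₁).mulVec (massVec β [] p q) ∧
      translateMass β p q [1, 0] 0 0 0 = (1 / 2 : ℝ) ^ 2 * massVec β [] p q 2 := by
  obtain ⟨b1, b2⟩ := base_mem h
  obtain ⟨s1, s2⟩ := base_sq_mem h
  obtain ⟨⟨x0, x1, x2, x3, x4, x5⟩, y0, y1, y2, y3, y4, y5⟩ := wordMap_zero_one h
  have st := fun d w a b c => translateMass_cons h p q d w a b c
  have lo := fun {w a b c} => translateMass_eq_zero_of_le (by linarith : 1 < β) (p := p) hq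
    (w := w) (a := a) (b := b) (c := c)
  have hi := fun {w a b c} => translateMass_eq_zero_of_ge (by linarith : 1 < β) (q := q) hp
    (w := w) (a := a) (b := b) (c := c)
  rw [M₁_mulVec]
  unfold massVec
  generalize translateMass β p q = V at *
  have h0 : V [1, 0] 0 0 0 = 1 / 2 * V [0] 1 0 0 + 1 / 2 * V [0] 2 (-1) 0 := by norm_num [st]
  have h1 : V [0] 1 0 0 = 0 := hi (by linarith)
  have h2 : V [0] 2 (-1) 0 = 1 / 2 * V [] 0 2 (-1) + 1 / 2 * V [] 1 1 (-1) := by norm_num [st]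
  have h3 : V [1, 0] 1 (-1) 0 = 1 / 2 * V [0] 1 1 (-1) + 1 / 2 * V [0] 2 0 (-1) := by norm_num [st]
  have h4 : V [0] 1 1 (-1) = 1 / 2 * V [] (-1) 2 (-1) + 1 / 2 * V [] 0 1 (-1) := by norm_num [st]
  have h5 : V [] 0 1 (-1) = 0 := lo (by linarith)
  have h6 : V [0] 2 0 (-1) = 0 := lo (by linarith)
  have h7 : V [1, 0] 0 2 (-1) = 0 := hi (by linarith)
  have h8 : V [1, 0] 1 1 (-1) = 1 / 2 * V [0] 0 2 (-1) + 1 / 2 * V [0] 1 1 (-1) := by norm_num [st]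
  have h9 : V [0] 0 2 (-1) = 1 / 2 * V [] (-1) 1 0 + 1 / 2 * V [] 0 0 0 := by norm_num [st]
  have h10 : V [1, 0] (-1) 1 0 = 0 := hi (by linarith)
  have h11 : V [1, 0] (-1) 2 (-1) = 1 / 2 * V [0] 0 0 0 + 1 / 2 * V [0] 1 (-1) 0 := by norm_num [st]
  have h12 : V [0] 0 0 0 = 1 / 2 * V [] 0 0 0 + 1 / 2 * V [] 1 (-1) 0 := by norm_num [st]
  have h13 : V [0] 1 (-1) 0 = 0 := lo (by linarith)
  have h14 : V [1, 0] 1 (-2) 1 = 0 := hi (by linarith)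
  have h15 : V [1, 0] 2 (-1) 0 = 1 / 2 * V [0] 1 2 (-1) + 1 / 2 * V [0] 2 1 (-1) := by norm_num [st]
  have h16 : V [0] 1 2 (-1) = 0 := hi (by linarith)
  have h17 : V [0] 2 1 (-1) = 1 / 2 * V [] (-1) 3 (-1) + 1 / 2 * V [] 0 2 (-1) := by norm_num [st]
  have h18 : V [] (-1) 3 (-1) = 0 := hi (by linarith)
  refine ⟨?_, ?_⟩
  · ext i
    fin_cases i <;> simp <;> linarith
  · simp
    linarith

/-- The parameter is `e = 0` because the translate of the interval of 1100 by `2 * β - β ^ 2` begins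
at `β ^ 2 - β`, which exceeds 1. -/
lemma massVec_word_two {β : ℝ} (h : β ^ 3 = 2 * β ^ 2 - β + 1) {p q : ℝ} (hp : 0 ≤ p)
    (hq : q ≤ 1) :
    massVec β [1, 1, 0, 0] p q = (1 / 2 : ℝ) ^ 4 • (M₂ 0).mulVec (massVec β [] p q) ∧
      translateMass β p q [1, 1, 0, 0] 0 0 0 = (1 / 2 : ℝ) ^ 4 * massVec β [] p q 4 := by
  obtain ⟨b1, b2⟩ := base_mem h
  obtain ⟨s1, s2⟩ := base_sq_mem h
  obtain ⟨⟨x0, x1, x2, x3, x4, x5⟩, y0, y1, y2, y3, y4, y5⟩ := wordMap_zero_one h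
  have st := fun d w a b c => translateMass_cons h p q d w a b c
  have lo := fun {w a b c} => translateMass_eq_zero_of_le (by linarith : 1 < β) (p := p) hq
    (w := w) (a := a) (b := b) (c := c)
  have hi := fun {w a b c} => translateMass_eq_zero_of_ge (by linarith : 1 < β) (q := q) hp
    (w := w) (a := a) (b := b) (c := c)
  rw [M₂_mulVec]
  unfold massVec
  generalize translateMass β p q = V at *
  have h0 : V [1, 1, 0, 0] 0 0 0 = 1 / 2 * V [1, 0, 0] 1 0 0 + 1 / 2 * V [1, 0, 0] 2 (-1) 0 := by norm_num [st]
  have h1 : V [1, 0, 0] 1 0 0 = 0 := hi (by linarith)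
  have h2 : V [1, 0, 0] 2 (-1) 0 = 1 / 2 * V [0, 0] 1 2 (-1) + 1 / 2 * V [0, 0] 2 1 (-1) := by norm_num [st]
  have h3 : V [0, 0] 1 2 (-1) = 0 := hi (by linarith)
  have h4 : V [0, 0] 2 1 (-1) = 1 / 2 * V [0] (-1) 3 (-1) + 1 / 2 * V [0] 0 2 (-1) := by norm_num [st]
  have h5 : V [0] (-1) 3 (-1) = 0 := hi (by linarith)
  have h6 : V [0] 0 2 (-1) = 1 / 2 * V [] (-1) 1 0 + 1 / 2 * V [] 0 0 0 := by norm_num [st]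
  have h7 : V [1, 1, 0, 0] 1 (-1) 0 = 1 / 2 * V [1, 0, 0] 1 1 (-1) + 1 / 2 * V [1, 0, 0] 2 0 (-1) := by norm_num [st]
  have h8 : V [1, 0, 0] 1 1 (-1) = 1 / 2 * V [0, 0] 0 2 (-1) + 1 / 2 * V [0, 0] 1 1 (-1) := by norm_num [st]
  have h9 : V [0, 0] 0 2 (-1) = 1 / 2 * V [0] (-1) 1 0 + 1 / 2 * V [0] 0 0 0 := by norm_num [st]
  have h10 : V [0] (-1) 1 0 = 1 / 2 * V [] 0 (-1) 1 + 1 / 2 * V [] 1 (-2) 1 := by norm_num [st]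
  have h11 : V [] 0 (-1) 1 = 0 := hi (by linarith)
  have h12 : V [0] 0 0 0 = 1 / 2 * V [] 0 0 0 + 1 / 2 * V [] 1 (-1) 0 := by norm_num [st]
  have h13 : V [0, 0] 1 1 (-1) = 0 := lo (by linarith)
  have h14 : V [1, 0, 0] 2 0 (-1) = 0 := lo (by linarith)
  have h15 : V [1, 1, 0, 0] 0 2 (-1) = 0 := hi (by linarith)
  have h16 : V [1, 1, 0, 0] 1 1 (-1) = 1 / 2 * V [1, 0, 0] 0 2 (-1) + 1 / 2 * V [1, 0, 0] 1 1 (-1) := by norm_num [st]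
  have h17 : V [1, 0, 0] 0 2 (-1) = 0 := hi (by linarith)
  have h18 : V [1, 1, 0, 0] (-1) 1 0 = 0 := hi (by linarith)
  have h19 : V [1, 1, 0, 0] (-1) 2 (-1) = 1 / 2 * V [1, 0, 0] 0 0 0 + 1 / 2 * V [1, 0, 0] 1 (-1) 0 := by norm_num [st]
  have h20 : V [1, 0, 0] 0 0 0 = 1 / 2 * V [0, 0] 1 0 0 + 1 / 2 * V [0, 0] 2 (-1) 0 := by norm_num [st]
  have h21 : V [0, 0] 1 0 0 = 0 := hi (by linarith)
  have h22 : V [0, 0] 2 (-1) 0 = 1 / 2 * V [0] 0 2 (-1) + 1 / 2 * V [0] 1 1 (-1) := by norm_num [st]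
  have h23 : V [0] 1 1 (-1) = 1 / 2 * V [] (-1) 2 (-1) + 1 / 2 * V [] 0 1 (-1) := by norm_num [st]
  have h24 : V [] 0 1 (-1) = 0 := lo (by linarith)
  have h25 : V [1, 0, 0] 1 (-1) 0 = 0 := lo (by linarith)
  have h26 : V [1, 1, 0, 0] 1 (-2) 1 = 0 := hi (by linarith)
  have h27 : V [1, 1, 0, 0] 2 (-1) 0 = 0 := hi (by linarith)
  refine ⟨?_, ?_⟩
  · ext i
    fin_cases i <;> simp <;> linarith
  · simp
    linarith


/-! ### Positivity of the initial mass vector -/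

lemma half_rescaled_Ico_le_left {β : ℝ} (hβ : 1 < β) {x y x' y' : ℝ} (hx : β * x ≤ x')
    (hy : y' ≤ β * y) :
    1 / 2 * (rescaledBernoulliConvolution β).real (Ico x' y') ≤
      (rescaledBernoulliConvolution β).real (Ico x y) := by
  have := isProbabilityMeasure_rescaled hβ
  rw [rescaled_Ico hβ x y]
  have h := measureReal_mono (μ := rescaledBernoulliConvolution β) (Ico_subset_Ico hx hy)
  have h' := measureReal_nonneg (μ := rescaledBernoulliConvolution β)
    (s := Ico (β * x - (β - 1)) (β * y - (β - 1)))
  linarith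

lemma half_rescaled_Ico_le_right {β : ℝ} (hβ : 1 < β) {x y x' y' : ℝ}
    (hx : β * x - (β - 1) ≤ x') (hy : y' ≤ β * y - (β - 1)) :
    1 / 2 * (rescaledBernoulliConvolution β).real (Ico x' y') ≤
      (rescaledBernoulliConvolution β).real (Ico x y) := by
  have := isProbabilityMeasure_rescaled hβ
  rw [rescaled_Ico hβ x y]
  have h := measureReal_mono (μ := rescaledBernoulliConvolution β) (Ico_subset_Ico hx hy)
  have h' := measureReal_nonneg (μ := rescaledBernoulliConvolution β)
    (s := Ico (β * x) (β * y))
  linarith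

/-- One or two applications of self-similarity place the image of `[0, 1)` under a branch inside
each of the translates used, giving mass at least 1/2 or 1/4. Positivity is what allows this vector
to play the role of `c`. -/
lemma massVec_zero_one_pos {β : ℝ} (h : β ^ 3 = 2 * β ^ 2 - β + 1) (i : Fin 7) :
    0 < massVec β [] 0 1 i := by
  obtain ⟨b1, b2⟩ := base_mem h
  obtain ⟨s1, s2⟩ := base_sq_mem h
  have hβ : 1 < β := by linarith
  have := isProbabilityMeasure_rescaled hβ
  have m0 : (rescaledBernoulliConvolution β).real (Ico 0 1) = 1 := by
    simp [Measure.real, rescaled_Ico_zero_one hβ]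
  have e : ∀ a b c, translateMass β 0 1 [] a b c = (rescaledBernoulliConvolution β).real
    (Ico (0 + (a + b * β + c * β ^ 2)) (1 + (a + b * β + c * β ^ 2))) := fun a b c => rfl
  have nn : ∀ a b c, 0 ≤ translateMass β 0 1 [] a b c := fun _ _ _ => measureReal_nonneg
  have h0 : translateMass β 0 1 [] 0 0 0 = 1 := by rw [e]; simpa using m0
  have h2 : 1 / 2 ≤ translateMass β 0 1 [] 0 2 (-1) := by
    rw [e]
    have := half_rescaled_Ico_le_right hβ (x := 0 + (0 + 2 * β + -1 * β ^ 2))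
      (y := 1 + (0 + 2 * β + -1 * β ^ 2)) (x' := 0) (y' := 1) (by nlinarith) (by nlinarith)
    linarith
  have h7 : 1 / 2 ≤ translateMass β 0 1 [] 2 (-1) 0 := by
    rw [e]
    have := half_rescaled_Ico_le_right hβ (x := 0 + (2 + -1 * β + 0 * β ^ 2))
      (y := 1 + (2 + -1 * β + 0 * β ^ 2)) (x' := 0) (y' := 1) (by nlinarith) (by nlinarith)
    linarith
  have h6 : 1 / 4 ≤ translateMass β 0 1 [] 1 (-2) 1 := by
    rw [e] at h7 ⊢
    have := half_rescaled_Ico_le_right hβ (x := 0 + (1 + -2 * β + 1 * β ^ 2))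
      (y := 1 + (1 + -2 * β + 1 * β ^ 2)) (x' := 0 + (2 + -1 * β + 0 * β ^ 2))
      (y' := 1 + (2 + -1 * β + 0 * β ^ 2)) (by nlinarith) (by nlinarith)
    linarith
  have h5 : 1 / 4 ≤ translateMass β 0 1 [] (-1) 2 (-1) := by
    rw [e]
    have h := half_rescaled_Ico_le_left hβ (x := 0) (y := β - 1) (x' := 0) (y' := 1) (by simp)
      (by nlinarith)
    have := half_rescaled_Ico_le_left hβ (x := 0 + (-1 + 2 * β + -1 * β ^ 2))
      (y := 1 + (-1 + 2 * β + -1 * β ^ 2)) (x' := 0) (y' := β - 1) (by nlinarith) (by nlinarith)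
    linarith
  have n1 := nn 1 (-1) 0
  have n3 := nn 1 1 (-1)
  have n4 := nn (-1) 1 0
  unfold massVec
  generalize translateMass β 0 1 [] = V at *
  fin_cases i <;> simp <;> linarith

/-! ### Compositions of the maps of the system -/

/-- The words of the numeration. -/
def betaWord : Fin 3 → List ℕ := ![[0], [1, 0], [1, 1, 0, 0]]

lemma betaSystem_apply (β : ℝ) (i : Fin 3) : betaSystem β i = wordMap β (betaWord i) := by
  fin_cases i <;> rfl

lemma iterComp_succ' {b : ℕ} (S : Fin b → ℝ → ℝ) (ω : ℕ → Fin b) (n : ℕ) :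
    iterComp S ω (n + 1) = S (ω 0) ∘ iterComp S (shift 1 ω) n := by
  induction n with
  | zero => rfl
  | succ n ih =>
    change iterComp S ω (n + 1) ∘ S (ω (n + 1)) = _
    rw [ih]
    rfl

lemma wordMap_zero_nonneg {β : ℝ} (h : β ^ 3 = 2 * β ^ 2 - β + 1) (i : Fin 3) :
    0 ≤ wordMap β (betaWord i) 0 := by
  obtain ⟨b1, b2⟩ := base_mem h
  obtain ⟨⟨x0, x1, x2, x3, x4, x5⟩, -⟩ := wordMap_zero_one h
  fin_cases i
  · exact x1.ge
  · exact x3.symm ▸ (by nlinarith)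
  · exact x5.symm ▸ (by nlinarith)

lemma wordMap_one_le {β : ℝ} (h : β ^ 3 = 2 * β ^ 2 - β + 1) (i : Fin 3) :
    wordMap β (betaWord i) 1 ≤ 1 := by
  obtain ⟨b1, b2⟩ := base_mem h
  obtain ⟨-, y0, y1, y2, y3, y4, y5⟩ := wordMap_zero_one h
  fin_cases i
  · exact y1.trans_le (by nlinarith)
  · exact y3.trans_le (by nlinarith)
  · exact y5.le

lemma betaSystem_nonneg {β : ℝ} (h : β ^ 3 = 2 * β ^ 2 - β + 1) (i : Fin 3) {x : ℝ}
    (hx : 0 ≤ x) : 0 ≤ betaSystem β i x := by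
  rw [betaSystem_apply]
  exact (wordMap_zero_nonneg h i).trans (wordMap_mono (by linarith [(base_mem h).1]) _ hx)

lemma betaSystem_le_one {β : ℝ} (h : β ^ 3 = 2 * β ^ 2 - β + 1) (i : Fin 3) {x : ℝ}
    (hx : x ≤ 1) : betaSystem β i x ≤ 1 := by
  rw [betaSystem_apply]
  exact (wordMap_mono (by linarith [(base_mem h).1]) _ hx).trans (wordMap_one_le h i)

lemma iterComp_nonneg {β : ℝ} (h : β ^ 3 = 2 * β ^ 2 - β + 1) (n : ℕ) (ω : ℕ → Fin 3) {x : ℝ}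
    (hx : 0 ≤ x) : 0 ≤ iterComp (betaSystem β) ω n x := by
  induction n generalizing x with
  | zero => exact hx
  | succ n ih => exact ih (betaSystem_nonneg h _ hx)

lemma iterComp_le_one {β : ℝ} (h : β ^ 3 = 2 * β ^ 2 - β + 1) (n : ℕ) (ω : ℕ → Fin 3) {x : ℝ}
    (hx : x ≤ 1) : iterComp (betaSystem β) ω n x ≤ 1 := by
  induction n generalizing x with
  | zero => exact hx
  | succ n ih => exact ih (betaSystem_le_one h _ hx)

lemma wordMap_image_Ico {β : ℝ} (hβ : 0 < β) (w : List ℕ) (x y : ℝ) :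
    wordMap β w '' Ico x y = Ico (wordMap β w x) (wordMap β w y) := by
  induction w with
  | nil => exact image_id _
  | cons d w ih =>
    have e : wordMap β (d :: w) = (fun z => ((d : ℝ) + z) / β) ∘ wordMap β w := rfl
    rw [e, image_comp, ih]
    ext z
    simp only [mem_image, mem_Ico, Function.comp_apply]
    constructor
    · rintro ⟨u, ⟨h1, h2⟩, rfl⟩
      constructor <;> gcongr
    · rintro ⟨h1, h2⟩
      rw [div_le_iff₀ hβ] at h1
      rw [lt_div_iff₀ hβ] at h2
      exact ⟨z * β - d, ⟨by linarith, by linarith⟩, by field_simp; ring⟩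

lemma betaSystem_image_Ico {β : ℝ} (hβ : 0 < β) (i : Fin 3) (x y : ℝ) :
    betaSystem β i '' Ico x y = Ico (betaSystem β i x) (betaSystem β i y) := by
  rw [betaSystem_apply, wordMap_image_Ico hβ]

lemma basicInterval_eq_Ico {β : ℝ} (hβ : 0 < β) (ω : ℕ → Fin 3) (n : ℕ) :
    basicInterval (betaSystem β) ω n =
      Ico (iterComp (betaSystem β) ω n 0) (iterComp (betaSystem β) ω n 1) := by
  have : ∀ x y, iterComp (betaSystem β) ω n '' Ico x y =
      Ico (iterComp (betaSystem β) ω n x) (iterComp (betaSystem β) ω n y) := by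
    induction n with
    | zero => exact fun x y => image_id _
    | succ n ih =>
      intro x y
      change (_ ∘ _) '' _ = _
      rw [image_comp, betaSystem_image_Ico hβ, ih]
      rfl
  exact this 0 1

/-- The logarithm of the weight of a symbol. -/
noncomputable def logWeight (i : Fin 3) : ℝ := (betaWord i).length * Real.log (1 / 2)

lemma exp_logWeight (i : Fin 3) : Real.exp (logWeight i) = (1 / 2) ^ (betaWord i).length := by
  rw [logWeight, Real.exp_nat_mul, Real.exp_log (by norm_num)]

lemma massVec_betaWord {β : ℝ} (h : β ^ 3 = 2 * β ^ 2 - β + 1) (i : Fin 3) {p q : ℝ}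
    (hp : 0 ≤ p) (hq : q ≤ 1) :
    massVec β (betaWord i) p q =
        Real.exp (logWeight i) • (matrices 0 i).mulVec (massVec β [] p q) ∧
      translateMass β p q (betaWord i) 0 0 0 =
        Real.exp (logWeight i) * massVec β [] p q ((![0, 2, 4] : Fin 3 → Fin 7) i) := by
  rw [exp_logWeight]
  fin_cases i
  exacts [massVec_word_zero h hp hq, massVec_word_one h hp hq, massVec_word_two h hp hq]

/-- Induction removes the innermost map by passing from `p, q` to their images, which stay in `[0,
1]`; this keeps the matrices in the order of the letters. -/
lemma massVec_iterComp {β : ℝ} (h : β ^ 3 = 2 * β ^ 2 - β + 1) (ω : ℕ → Fin 3) (n : ℕ) {p q : ℝ}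
    (hp : 0 ≤ p) (hq : q ≤ 1) :
    massVec β [] (iterComp (betaSystem β) ω n p) (iterComp (betaSystem β) ω n q) =
      Real.exp (∑ k ∈ Finset.range n, logWeight (ω k)) •
        (prefixProd (matrices 0) ω n).mulVec (massVec β [] p q) := by
  induction n generalizing p q with
  | zero => simp [iterComp, prefixProd]
  | succ n ih =>
    change massVec β [] (iterComp _ ω n (betaSystem β (ω n) p))
      (iterComp _ ω n (betaSystem β (ω n) q)) = _
    rw [ih (betaSystem_nonneg h _ hp) (betaSystem_le_one h _ hq), betaSystem_apply,
      massVec_wordMap, (massVec_betaWord h _ hp hq).1, Matrix.mulVec_smul, smul_smul,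
      Matrix.mulVec_mulVec, Finset.sum_range_succ, Real.exp_add]
    rfl

/-- The mass of an interval is the untranslated term alone, which is not an entry of `massVec`. The
outermost letter is therefore treated apart: it turns this mass into the entry 0, 2 or 4 of the
vector for the remaining letters. -/
lemma rescaled_basicInterval {β : ℝ} (h : β ^ 3 = 2 * β ^ 2 - β + 1) (ω : ℕ → Fin 3) (n : ℕ) :
    (rescaledBernoulliConvolution β).real (basicInterval (betaSystem β) ω (n + 1)) =
      Real.exp (∑ k ∈ Finset.range (n + 1), logWeight (ω k)) *
        (prefixProd (matrices 0) (shift 1 ω) n).mulVec (massVec β [] 0 1)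
          ((![0, 2, 4] : Fin 3 → Fin 7) (ω 0)) := by
  have hβ : 0 < β := by linarith [(base_mem h).1]
  have e := (massVec_betaWord h (ω 0) (iterComp_nonneg h n (shift 1 ω) le_rfl)
    (iterComp_le_one h n (shift 1 ω) le_rfl)).2
  rw [massVec_iterComp h _ _ le_rfl le_rfl, Pi.smul_apply, smul_eq_mul, ← mul_assoc,
    ← Real.exp_add] at e
  rw [basicInterval_eq_Ico hβ, iterComp_succ', Finset.sum_range_succ', add_comm (∑ _ ∈ _, _)]
  refine Eq.trans ?_ e
  simp [translateMass, betaSystem_apply]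

/-! ### The coding -/

lemma betaSystem_endpoints {β : ℝ} (h : β ^ 3 = 2 * β ^ 2 - β + 1) :
    betaSystem β 0 0 = 0 ∧ betaSystem β 0 1 = betaSystem β 1 0 ∧
      betaSystem β 1 1 = betaSystem β 2 0 ∧ betaSystem β 2 1 = 1 ∧
      betaSystem β 1 0 < betaSystem β 2 0 := by
  obtain ⟨b1, b2⟩ := base_mem h
  obtain ⟨⟨x0, x1, x2, x3, x4, x5⟩, y0, y1, y2, y3, y4, y5⟩ := wordMap_zero_one h
  refine ⟨x1, y1.trans x3.symm, y3.trans x5.symm, y5, ?_⟩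
  change wordMap β [1, 0] 0 < wordMap β [1, 1, 0, 0] 0
  rw [x3, x5]
  nlinarith

/-- The number of the basic interval of order one that contains a point of `[0, 1)`. -/
noncomputable def betaDigit (β x : ℝ) : Fin 3 :=
  if x < betaSystem β 1 0 then 0 else if x < betaSystem β 2 0 then 1 else 2

lemma betaDigit_eq_iff {β : ℝ} (h : β ^ 3 = 2 * β ^ 2 - β + 1) {x : ℝ} (hx : x ∈ Ico (0 : ℝ) 1)
    (i : Fin 3) : betaDigit β x = i ↔ x ∈ betaSystem β i '' Ico 0 1 := by
  obtain ⟨e0, e1, e2, e3, e4⟩ := betaSystem_endpoints h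
  rw [betaSystem_image_Ico (by linarith [(base_mem h).1])]
  have h0 := hx.1
  have h1 := hx.2
  unfold betaDigit
  fin_cases i <;> simp only [Fin.zero_eta, Fin.mk_one, Fin.reduceFinMk, e0, e1, e2, e3, mem_Ico] <;>
    split_ifs <;> simp <;> first | linarith | (intros; linarith) | (constructor <;> linarith)

lemma isAffineSystem_betaSystem {β : ℝ} (h : β ^ 3 = 2 * β ^ 2 - β + 1) :
    IsAffineSystem (betaSystem β) where
  affine i := by
    have hβ : 1 < β := by linarith [(base_mem h).1]
    have key : ∀ w : List ℕ, ∀ x, wordMap β w x = β⁻¹ ^ w.length * x + wordMap β w 0 := by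
      intro w
      induction w with
      | nil => intro x; simp [wordMap]
      | cons d w ih =>
        intro x
        rw [wordMap_cons, wordMap_cons, ih x, List.length_cons, pow_succ]
        ring
    refine ⟨β⁻¹ ^ (betaWord i).length, wordMap β (betaWord i) 0, ?_, fun x => ?_⟩
    · rw [abs_of_pos (by positivity)]
      exact pow_lt_one₀ (by positivity) (inv_lt_one_of_one_lt₀ hβ)
        (by fin_cases i <;> simp [betaWord])
    · rw [betaSystem_apply, key]
  cover := by
    ext x
    rw [mem_iUnion]
    constructor
    · rintro ⟨i, hi⟩
      rw [betaSystem_image_Ico (by linarith [(base_mem h).1])] at hi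
      exact ⟨(betaSystem_nonneg h i le_rfl).trans hi.1,
        hi.2.trans_le (betaSystem_le_one h i le_rfl)⟩
    · exact fun hx => ⟨_, (betaDigit_eq_iff h hx _).1 rfl⟩
  disjoint i j hij := by
    refine Set.disjoint_left.2 fun x hi hj => hij ?_
    have hx : x ∈ Ico (0 : ℝ) 1 := by
      have hi' := hi
      rw [betaSystem_image_Ico (by linarith [(base_mem h).1])] at hi'
      exact ⟨(betaSystem_nonneg h i le_rfl).trans hi'.1,
        hi'.2.trans_le (betaSystem_le_one h i le_rfl)⟩
    exact ((betaDigit_eq_iff h hx i).2 hi).symm.trans ((betaDigit_eq_iff h hx j).2 hj)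

/-- The inverse of `wordMap`. -/
def wordInv (β : ℝ) (w : List ℕ) (x : ℝ) : ℝ := w.foldl (fun y ε => β * y - ε) x

lemma wordInv_wordMap {β : ℝ} (hβ : β ≠ 0) (w : List ℕ) (x : ℝ) :
    wordInv β w (wordMap β w x) = x := by
  induction w with
  | nil => rfl
  | cons d w ih =>
    change wordInv β w (β * ((d + wordMap β w x) / β) - d) = x
    rw [mul_div_cancel₀ _ hβ, add_sub_cancel_left, ih]

lemma measurable_wordInv (β : ℝ) (w : List ℕ) : Measurable (wordInv β w) := by
  induction w with
  | nil => exact measurable_id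
  | cons d w ih => exact ih.comp ((measurable_const_mul β).sub_const _)

/-- The expanding map whose inverse branches are the maps of the system. -/
noncomputable def betaExpand (β x : ℝ) : ℝ := wordInv β (betaWord (betaDigit β x)) x

/-- The sequence of the numbers of the words of the expansion of `x`. -/
noncomputable def betaCode (β x : ℝ) (n : ℕ) : Fin 3 := betaDigit β ((betaExpand β)^[n] x)

lemma measurable_betaDigit (β : ℝ) : Measurable (betaDigit β) :=
  Measurable.ite measurableSet_Iio measurable_const
    (Measurable.ite measurableSet_Iio measurable_const measurable_const)

lemma measurable_betaExpand (β : ℝ) : Measurable (betaExpand β) := by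
  have e : betaExpand β = (fun z : Fin 3 × ℝ => wordInv β (betaWord z.1) z.2) ∘
      fun x => (betaDigit β x, x) := rfl
  rw [e]
  exact (measurable_from_prod_countable_right fun i => measurable_wordInv β _).comp
    ((measurable_betaDigit β).prodMk measurable_id)

lemma measurable_betaCode (β : ℝ) : Measurable (betaCode β) :=
  measurable_pi_lambda _ fun n =>
    (measurable_betaDigit β).comp ((measurable_betaExpand β).iterate n)

lemma basicInterval_subset {β : ℝ} (h : β ^ 3 = 2 * β ^ 2 - β + 1) (ω : ℕ → Fin 3) (n : ℕ) :
    basicInterval (betaSystem β) ω n ⊆ Ico 0 1 := by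
  rw [basicInterval_eq_Ico (by linarith [(base_mem h).1])]
  exact Ico_subset_Ico (iterComp_nonneg h n ω le_rfl) (iterComp_le_one h n ω le_rfl)

/-- On the piece of digit `j` the expanding map inverts `betaSystem β j` and shifts the code, so
both sides reduce to the same assertion for the preimage point. -/
lemma forall_betaCode_eq_iff {β : ℝ} (h : β ^ 3 = 2 * β ^ 2 - β + 1) (n : ℕ) {x : ℝ}
    (hx : x ∈ Ico (0 : ℝ) 1) (ω : ℕ → Fin 3) :
    (∀ i < n, betaCode β x i = ω i) ↔ x ∈ basicInterval (betaSystem β) ω n := by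
  have h0 : β ≠ 0 := by linarith [(base_mem h).1]
  induction n generalizing x ω with
  | zero => simpa [basicInterval, iterComp] using hx
  | succ n ih =>
    obtain ⟨j, hj⟩ : ∃ j, betaDigit β x = j := ⟨_, rfl⟩
    obtain ⟨y, hy, rfl⟩ := (betaDigit_eq_iff h hx j).1 hj
    have e : betaExpand β (betaSystem β j y) = y := by
      rw [betaExpand, hj, betaSystem_apply, wordInv_wordMap h0]
    have e1 : ∀ i, betaCode β (betaSystem β j y) (i + 1) = betaCode β y i := fun i => by
      rw [betaCode, Function.iterate_succ_apply, e, betaCode]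
    have e2 : basicInterval (betaSystem β) ω (n + 1) =
        betaSystem β (ω 0) '' basicInterval (betaSystem β) (shift 1 ω) n := by
      rw [basicInterval, iterComp_succ', image_comp, basicInterval]
    rw [e2]
    constructor
    · intro H
      have hj0 : j = ω 0 := hj.symm.trans (H 0 n.succ_pos)
      rw [hj0]
      refine mem_image_of_mem _ ((ih hy (shift 1 ω)).1 fun i hi => ?_)
      rw [← e1]
      exact H (i + 1) (Nat.succ_lt_succ hi)
    · rintro ⟨z, hz, hzy⟩
      have hz1 : z ∈ Ico (0 : ℝ) 1 := basicInterval_subset h _ _ hz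
      have hj0 : j = ω 0 := hj.symm.trans ((betaDigit_eq_iff h hx _).2 ⟨z, hz1, hzy⟩)
      have hzy' : z = y := by
        rw [hj0, betaSystem_apply] at hzy
        rw [← wordInv_wordMap h0 (betaWord (ω 0)) z, hzy, wordInv_wordMap h0]
      rintro (_ | i) hi
      · exact hj.trans hj0
      · rw [e1]
        exact (ih hy (shift 1 ω)).2 (hzy' ▸ hz) i (Nat.lt_of_succ_lt_succ hi)

lemma rescaled_preimage_cylinder {β : ℝ} (h : β ^ 3 = 2 * β ^ 2 - β + 1) (ω : ℕ → Fin 3)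
    (n : ℕ) :
    (rescaledBernoulliConvolution β) (betaCode β ⁻¹' PiNat.cylinder ω n) =
      (rescaledBernoulliConvolution β) (basicInterval (betaSystem β) ω n) := by
  have hβ : 1 < β := by linarith [(base_mem h).1]
  have := isProbabilityMeasure_rescaled hβ
  -- The coding describes only points of `[0, 1)`; the point 1 is negligible.
  have hae : ∀ᵐ x ∂(rescaledBernoulliConvolution β), x ∈ Ico (0 : ℝ) 1 :=
    (mem_ae_iff_prob_eq_one measurableSet_Ico).2 (rescaled_Ico_zero_one hβ)
  refine measure_congr ?_
  filter_upwards [hae] with x hx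
  exact propext ((by simp only [mem_preimage, PiNat.mem_cylinder_iff] :
    (x ∈ betaCode β ⁻¹' PiNat.cylinder ω n) ↔ ∀ i < n, betaCode β x i = ω i).trans
    (forall_betaCode_eq_iff h n hx ω))

end WeakGibbs

theorem theorem2p3 :
    (∀ e : ℝ, e = 0 ∨ e = 1 → ∀ c : Fin 7 → ℝ, (∀ i, 0 < c i) →
      (∀ (ω : ℕ → Fin 3) (n : ℕ),
        (WeakGibbs.prefixProd (WeakGibbs.matrices e) ω n).mulVec c ≠ 0) ∧
      ∃ l : (ℕ → Fin 3) → Fin 7 → ℝ,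
        TendstoUniformly
          (fun (n : ℕ) (ω : ℕ → Fin 3) =>
            WeakGibbs.normalized ((WeakGibbs.prefixProd (WeakGibbs.matrices e) ω n).mulVec c))
          l atTop) ∧
    (∀ β : ℝ, β ^ 3 = 2 * β ^ 2 - β + 1 →
      WeakGibbs.IsWeakGibbsFor (WeakGibbs.betaSystem β)
        (WeakGibbs.rescaledBernoulliConvolution β)) := by
  open WeakGibbs in
  refine ⟨fun e he c hc => ⟨fun ω n => ?_, exists_tendstoUniformly_normalized he hc⟩,
    fun β h => ?_⟩
  · obtain ⟨t, ht, hct⟩ := exists_mem_cone hc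
    exact (orbit_mem_cone he ht hct ω n).2
  · have hβ : 1 < β := by linarith [(base_mem h).1]
    have hp := isProbabilityMeasure_rescaled hβ
    have hcyl : ∀ ω n, ((rescaledBernoulliConvolution β).map (betaCode β)) (PiNat.cylinder ω n) =
        (rescaledBernoulliConvolution β) (basicInterval (betaSystem β) ω n) := fun ω n => by
      rw [Measure.map_apply (measurable_betaCode β) (PiNat.isOpen_cylinder _ ω n).measurableSet,
        rescaled_preimage_cylinder h]
    refine ⟨hp, rescaled_ae_mem hβ, isAffineSystem_betaSystem h, _,
      Measure.isProbabilityMeasure_map (measurable_betaCode β).aemeasurable, hcyl, ?_⟩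
    -- The Bernoulli convolution corresponds to `e = 0`, with initial vector the masses attached to
    -- `[0, 1)` itself.
    refine isWeakGibbs_of_matrices (Or.inl rfl) (massVec_zero_one_pos h) logWeight fun ω n => ?_
    rw [Measure.real, hcyl, ← rescaled_basicInterval h]
    rfl
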